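/- **Setting.** Let $G,H,K$ be compact Lie groups (more generally, topological groups), let $\phi:H\to G$ and $\psi:K\to H$ be continuous homomorphisms, and let $V$ be a finite-dimensional orthogonal real $G$-representation, regarded as an $H$-representation through $\phi$ and as a $K$-representation through $\phi\circ\psi$. Let $E$ be an orthogonal spectrum; only its underlying continuous functor $W\mapsto E(W)$, from finite-dimensional real inner product spaces and linear isometric isomorphisms to based spaces, is used, and the statement holds for every such functor. Write $G^{tors}$ for the set of elements of finite order of $G$ and $C_G(g)$ for the centralizer of $g$. For $g\in G^{tors}$ let $(V\otimes\mathbb C)_g$ be $V\otimes\mathbb C$ with $t\in\mathbb R$ acting as $e^{2\pi i c t}$ on the eigenspace of $g$ for the eigenvalue $e^{2\pi i c}$, $0<c\le 1$, and let $(V)^{\mathbb R}_g=(V\otimes\mathbb C)_g\oplus(V\otimes\mathbb C)_g^{*}$, considered as a real representation of $\Lambda_G(g)=C_G(g)\times\mathbb R/\langle (g,-1)\rangle$. Let $F_g(G,V)=\mathrm{Map}_{\mathbb R}\bigl(S^{(V)^{\mathbb R}_g},E((V)^{\mathbb R}_g\oplus V^g)\bigr)$ be the space of based $\mathbb R$-equivariant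 maps, with $\mathbb R$ acting trivially on $V^g$; its base point $c_0$ is the constant map. Let $\mathrm{Sym}(V)=\bigoplus_{n\ge 0}\mathrm{Sym}^n(V)$ with the norm induced from the inner products of the $V^{\otimes n}$, and let $S(G,V)_g=\mathrm{Sym}(V)\setminus \mathrm{Sym}(V)^g$. Let $QE_g(G,V)$ be the quotient of $$\{(a,b,t)\in F_g(G,V)\times\mathrm{Sym}(V)\times[0,1] : \|b\|\le t,\ b\in S(G,V)_g\text{ if }t\ne 0\}$$ obtained by identifying $(a,b,1)\sim(a',b,1)$ and collapsing all points $(c_0,b,t)$ to one point; the point $(a,b,t)$ is written $(1-t)a+tb$. The end $F_g(G,V)$ of this space consists of the points $(a,0,0)$. Let $$QE(G,V)=\prod_{g\in G^{tors}}\mathrm{Map}_{C_G(g)}(G,QE_g(G,V)),$$ where $G$ acts on each factor by $(x\cdot\alpha)(y)=\alpha(yx)$. For $\tau\in H^{tors}$ let $a_\tau:(V)^{\mathbb R}_{\phi(\tau)}\oplus V^{\phi(\tau)}\to (V)^{\mathbb R}_{\tau}\oplus V^{\tau}$ be the isomorphism $v\mapsto v$, let $res=res|^{\Lambda_G(\phi(\tau))}_{\Lambda_H(\tau)}:F_{\phi(\tau)}(G,V)\to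 F_\tau(H,V)$ be $\beta\mapsto E(a_\tau)\circ\beta$, let $r_{\phi,\tau}:QE_{\phi(\tau)}(G,V)\to QE_\tau(H,V)$ be the map $(1-t)a+tb\mapsto(1-t)\,res(a)+tb$, and let $$R_{\phi,\tau}:\mathrm{Map}_{C_G(\phi(\tau))}(G,QE_{\phi(\tau)}(G,V))\to\mathrm{Map}_{C_H(\tau)}(H,QE_\tau(H,V)),\qquad \alpha\mapsto r_{\phi,\tau}\circ\alpha\circ\phi .$$ The restriction map $\phi_V^*:QE(G,V)\to QE(H,V)$ is the continuous map whose component at $\tau\in H^{tors}$ is $R_{\phi,\tau}$ applied to the component at $\phi(\tau)$. **Statement.** (i) Let $\tau\in H^{tors}$ and $g=\phi(\tau)$. The inclusions of the ends $F_g(G,V)\to QE_g(G,V)$ and $F_\tau(H,V)\to QE_\tau(H,V)$ are injective, and $r_{\phi,\tau}$ restricts to $res$ on them. For every $\alpha\in \mathrm{Map}_{C_G(g)}(G,QE_g(G,V))$ one has $R_{\phi,\tau}(\alpha)(e)=r_{\phi,\tau}(\alpha(e))$, and $R_{\phi,\tau}(\phi(h)\cdot\alpha)=h\cdot R_{\phi,\tau}(\alpha)$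 for all $h\in H$. For every $G$-space $X$, every continuous $G$-map $f:X\to\mathrm{Map}_{C_G(g)}(G,QE_g(G,V))$ and every $x\in X^g$, the point $f(x)(e)$ lies in the end $F_g(G,V)$, the point $R_{\phi,\tau}(f(x))(e)$ lies in the end $F_\tau(H,V)$, and $$R_{\phi,\tau}(f(x))(e)=res|^{\Lambda_G(g)}_{\Lambda_H(\tau)}\bigl(f(x)(e)\bigr).$$ Consequently the same holds for $\phi^*_V$: if $f:X\to QE(G,V)$ is a continuous $G$-map and $x\in X^{g}$, then $(\phi_V^*f(x))_\tau(e)=res\bigl(f(x)_{g}(e)\bigr)$ in $F_\tau(H,V)$. (ii) $\psi_V^*\circ\phi_V^*=(\phi\circ\psi)_V^*$, and the composition of restriction maps is associative. (iii) $\mathrm{Id}_V^*:QE(G,V)\to QE(G,V)$ is the identity map. The maps $\phi_V^*$ send families extended conjugation-invariantly from a set $G^{tors}_{conj}$ of representatives of the conjugacy classes in $G^{tors}$ to families extended in the same way from $H^{tors}_{conj}$. Hence they induce restriction maps between the products $\prod_{g\in G^{tors}_{conj}}\mathrm{Map}_{C_G(g)}(G,QE_g(G,V))$, and (ii) (composition)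 and (iii) hold for these as well. -/

import Mathlib

open scoped TensorProduct

universe u v w

noncomputable section
namespace QERes

/-! ### Complexification, unitary dual, and the rotation action -/

section Complexification

variable (V : Type*) [NormedAddCommGroup V] [InnerProductSpace ℝ V]

/-- The complexification `V ⊗ ℂ` of a real inner product space. -/
def Cx : Type _ := ℂ ⊗[ℝ] V

instance : NormedAddCommGroup (Cx V) := inferInstanceAs (NormedAddCommGroup (ℂ ⊗[ℝ] V))
instance : InnerProductSpace ℝ (Cx V) := inferInstanceAs (InnerProductSpace ℝ (ℂ ⊗[ℝ] V))
instance Cx.module : Module ℂ (Cx V) := inferInstanceAs (Module ℂ (ℂ ⊗[ℝ] V))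
instance [FiniteDimensional ℝ V] : FiniteDimensional ℝ (Cx V) :=
  inferInstanceAs (FiniteDimensional ℝ (ℂ ⊗[ℝ] V))
instance : IsScalarTower ℝ ℂ (Cx V) := inferInstanceAs (IsScalarTower ℝ ℂ (ℂ ⊗[ℝ] V))

variable {V}

/-- Multiplication by a complex number of modulus one preserves the real inner product. -/
theorem Cx.inner_I_smul (x y : Cx V) :
    inner ℝ (Complex.I • x) (Complex.I • y) = inner ℝ x y := by
  have key : ∀ z : ℂ ⊗[ℝ] V, Complex.I • z =
      TensorProduct.map ((LinearIsometryEquiv.toLinearIsometry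
        (rotation (⟨Complex.I, by simp [Submonoid.unitSphere]⟩ : Circle))).toLinearMap)
        (LinearIsometry.id (R := ℝ) (E := V)).toLinearMap z := by
    intro z
    induction z using TensorProduct.induction_on with
    | zero => simp
    | tmul a v => rfl
    | add a b ha hb => rw [smul_add, ha, hb, map_add]
  have h : ∀ x y : ℂ ⊗[ℝ] V, inner ℝ (Complex.I • x) (Complex.I • y) = inner ℝ x y := by
    intro x y
    rw [key x, key y, TensorProduct.inner_map_map]
  exact h x y

/-- The hermitian inner product on the complexification: its real part is the real inner product. -/
def Cx.herm (x y : Cx V) : ℂ := ⟨inner ℝ x y, inner ℝ (Complex.I • x) y⟩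

theorem Cx.inner_I_smul_left (x y : Cx V) :
    inner ℝ (Complex.I • x) y = - inner ℝ x (Complex.I • y) := by
  have h := Cx.inner_I_smul x (Complex.I • y)
  rw [smul_smul, Complex.I_mul_I, neg_one_smul, inner_neg_right] at h
  linarith

theorem Cx.smul_eq (z : ℂ) (x : Cx V) : z • x = z.re • x + z.im • (Complex.I • x) := by
  have h1 : ∀ (r : ℝ) (y : Cx V), r • y = (r : ℂ) • y := fun r y => (Complex.coe_smul r y).symm
  rw [h1, h1, smul_smul, ← add_smul, Complex.re_add_im]

instance [FiniteDimensional ℝ V] : FiniteDimensional ℂ (Cx V) :=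
  FiniteDimensional.right ℝ ℂ (Cx V)

instance Cx.innerProductSpace : InnerProductSpace ℂ (Cx V) where
  norm_smul_le := by
    intro z x
    refine le_of_eq ?_
    rw [← sq_eq_sq₀ (norm_nonneg _) (by positivity), mul_pow, ← real_inner_self_eq_norm_sq, Cx.smul_eq, inner_add_left, inner_add_right, inner_add_right]
    simp only [real_inner_smul_left, real_inner_smul_right, Cx.inner_I_smul]
    have h : inner ℝ x (Complex.I • x) = 0 := by
      have h1 := Cx.inner_I_smul_left x x
      rw [real_inner_comm] at h1
      linarith
    rw [real_inner_comm x (Complex.I • x)] 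
    rw [h, ← real_inner_self_eq_norm_sq x, ← Complex.normSq_eq_norm_sq, Complex.normSq_apply]
    ring
  inner := Cx.herm
  norm_sq_eq_re_inner := by
    intro x
    simp [Cx.herm]
  conj_inner_symm := by
    intro x y
    apply Complex.ext
    · exact real_inner_comm _ _
    · simp only [Cx.herm, Complex.conj_im]
      rw [Cx.inner_I_smul_left, real_inner_comm]
      ring
  add_left := by
    intro x y z
    apply Complex.ext <;> simp [Cx.herm, inner_add_left]
  smul_left := by
    intro x y z
    apply Complex.ext
    · simp only [Cx.herm]
      rw [Cx.smul_eq, inner_add_left, real_inner_smul_left, real_inner_smul_left]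
      simp
    · simp only [Cx.herm]
      rw [smul_comm, Cx.smul_eq, inner_add_left, real_inner_smul_left, real_inner_smul_left,
        smul_smul, Complex.I_mul_I, neg_one_smul, inner_neg_left]
      simp

/-- The complex-linear extension of a real isometry. -/
def Cx.map {V W : Type*} [NormedAddCommGroup V] [InnerProductSpace ℝ V]
    [NormedAddCommGroup W] [InnerProductSpace ℝ W] (A : V ≃ₗᵢ[ℝ] W) : Cx V ≃ₗᵢ[ℂ] Cx W where
  toLinearEquiv := TensorProduct.AlgebraTensorModule.congr (LinearEquiv.refl ℂ ℂ) A.toLinearEquiv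
  norm_map' := fun x => (LinearIsometryEquiv.lTensor ℂ A).norm_map x

variable (V)

/-- The complex dual `(V ⊗ ℂ)^*`, with its operator norm. -/
abbrev CxDual [FiniteDimensional ℝ V] : Type _ := StrongDual ℂ (Cx V)

variable {V}

instance CxDual.innerProductSpace [FiniteDimensional ℝ V] : InnerProductSpace ℝ (CxDual V) where
  inner f h := inner ℝ ((InnerProductSpace.toDual ℂ (Cx V)).symm f)
    ((InnerProductSpace.toDual ℂ (Cx V)).symm h)
  norm_sq_eq_re_inner := by
    intro f
    rw [real_inner_self_eq_norm_sq, LinearIsometryEquiv.norm_map]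
    rfl
  conj_inner_symm := by
    intro f h
    exact real_inner_comm ((InnerProductSpace.toDual ℂ (Cx V)).symm f)
      ((InnerProductSpace.toDual ℂ (Cx V)).symm h)
  add_left := by
    intro f h k
    rw [map_add, inner_add_left]
  smul_left := by
    intro f h r
    have : r • f = (r : ℂ) • f := by
      ext x; simp
    rw [this, map_smulₛₗ, Complex.conj_ofReal, Complex.coe_smul]
    exact real_inner_smul_left _ _ _

instance [FiniteDimensional ℝ V] : FiniteDimensional ℝ (CxDual V) :=
  FiniteDimensional.trans ℝ ℂ (CxDual V)

end Complexification

section Rotation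

variable {W : Type*} [NormedAddCommGroup W] [InnerProductSpace ℂ W]

/-- The exponent `c ∈ (0, 1]` with `exp (2 π i c) = μ`, for `μ` of modulus one. -/
def expo (μ : ℂ) : ℝ :=
  if 0 < μ.arg then μ.arg / (2 * Real.pi) else μ.arg / (2 * Real.pi) + 1

/-- The scalar `exp (2 π i c t)`, where `c ∈ (0, 1]` and `exp (2 π i c) = μ`. -/
def rotScalar (μ : ℂ) (t : ℝ) : ℂ :=
  Complex.exp ((2 * Real.pi * expo μ * t : ℝ) * Complex.I)

theorem norm_rotScalar (μ : ℂ) (t : ℝ) : ‖rotScalar μ t‖ = 1 := Complex.norm_exp_ofReal_mul_I _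

theorem orthogonalFamily_eigenspaces (A : W ≃ₗᵢ[ℂ] W) :
    OrthogonalFamily ℂ
      (fun μ : Module.End.Eigenvalues (A.toLinearEquiv : Module.End ℂ W) =>
        Module.End.eigenspace (A.toLinearEquiv : Module.End ℂ W) (μ : ℂ))
      (fun μ => (Module.End.eigenspace (A.toLinearEquiv : Module.End ℂ W) (μ : ℂ)).subtypeₗᵢ) := by
  rintro ⟨μ, hμ⟩ ⟨ν, hν⟩ hne ⟨x, hx⟩ ⟨y, hy⟩
  have hne' : μ ≠ ν := fun h => hne (Subtype.ext h)
  have hx' : A x = μ • x := Module.End.mem_eigenspace_iff.mp hx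
  have hy' : A y = ν • y := Module.End.mem_eigenspace_iff.mp hy
  have h1 : ‖μ‖ = 1 := by
    obtain ⟨z, hz, hz0⟩ := (show Module.End.HasEigenvalue (A.toLinearEquiv : Module.End ℂ W) μ from
      hμ).exists_hasEigenvector
    have hz' : A z = μ • z := Module.End.mem_eigenspace_iff.mp hz
    have := A.norm_map z
    rw [hz', norm_smul] at this
    exact mul_right_cancel₀ (norm_ne_zero_iff.mpr hz0) (by rw [this, one_mul])
  have h2 : inner ℂ x y = (starRingEnd ℂ μ * ν) * inner ℂ x y := by
    conv_lhs => rw [← A.inner_map_map, hx', hy', inner_smul_left, inner_smul_right]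
    ring
  have h3 : starRingEnd ℂ μ * μ = 1 := by
    rw [mul_comm, Complex.mul_conj, Complex.normSq_eq_norm_sq, h1]; simp
  change inner ℂ x y = 0
  by_contra h0
  have h4 : starRingEnd ℂ μ * ν = 1 := by
    have : (starRingEnd ℂ μ * ν) * inner ℂ x y = 1 * inner ℂ x y := by rw [← h2, one_mul]
    exact mul_right_cancel₀ h0 this
  apply hne'
  have h5 : starRingEnd ℂ μ ≠ 0 := left_ne_zero_of_mul_eq_one h3
  exact mul_left_cancel₀ h5 (h3.trans h4.symm)

variable [FiniteDimensional ℂ W]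

theorem iSup_eigenspaces (A : W ≃ₗᵢ[ℂ] W) :
    ⨆ μ : Module.End.Eigenvalues (A.toLinearEquiv : Module.End ℂ W),
      Module.End.eigenspace (A.toLinearEquiv : Module.End ℂ W) (μ : ℂ) = ⊤ := by
  set T : Module.End ℂ W := (A.toLinearEquiv : Module.End ℂ W) with hT
  set S : Submodule ℂ W := ⨆ μ : Module.End.Eigenvalues T, Module.End.eigenspace T (μ : ℂ) with hS
  have hle : S.map T ≤ S := by
    rw [hS, Submodule.map_iSup]
    refine iSup_mono fun μ => ?_
    rintro _ ⟨x, hx, rfl⟩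
    have hx' : T x = (μ : ℂ) • x := Module.End.mem_eigenspace_iff.mp hx
    rw [hx']
    exact Submodule.smul_mem _ _ hx
  have hSmap : S.map T = S :=
    Submodule.eq_of_le_of_finrank_eq hle (LinearEquiv.finrank_map_eq A.toLinearEquiv S)
  have hinv : ∀ x ∈ Sᗮ, T x ∈ Sᗮ := by
    intro x hx y hy
    rw [← hSmap] at hy
    obtain ⟨z, hz, rfl⟩ := hy
    exact (A.inner_map_map z x).trans (hx z hz)
  by_contra htop
  have hbot : Sᗮ ≠ ⊥ := fun h => htop (Submodule.orthogonal_eq_bot_iff.mp h)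
  have : Nontrivial Sᗮ := Submodule.nontrivial_iff_ne_bot.mpr hbot
  obtain ⟨μ, hμ⟩ := Module.End.exists_eigenvalue (T.restrict hinv)
  obtain ⟨⟨z, hzS⟩, hz, hz0⟩ := hμ.exists_hasEigenvector
  have hz' : T z = μ • z := congrArg Subtype.val (Module.End.mem_eigenspace_iff.mp hz)
  have hz0' : z ≠ 0 := fun h => hz0 (Subtype.ext h)
  have hmem : z ∈ Module.End.eigenspace T μ := Module.End.mem_eigenspace_iff.mpr hz'
  have hev : T.HasEigenvalue μ := Module.End.hasEigenvalue_of_hasEigenvector ⟨hmem, hz0'⟩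
  have hzS' : z ∈ S :=
    (le_iSup (fun μ : Module.End.Eigenvalues T => Module.End.eigenspace T (μ : ℂ)) ⟨μ, hev⟩) hmem
  exact hz0' (inner_self_eq_zero.mp (hzS z hzS'))

/-- The linear operator acting on the `μ`-eigenspace of the unitary operator `A` as the scalar
`exp (2 π i c t)`, where `μ = exp (2 π i c)` and `0 < c ≤ 1`. -/
def rotLin (A : W ≃ₗᵢ[ℂ] W) (t : ℝ) : W →ₗ[ℂ] W :=
  ∑ μ : Module.End.Eigenvalues (A.toLinearEquiv : Module.End ℂ W),
    rotScalar (μ : ℂ) t •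
      ((Module.End.eigenspace (A.toLinearEquiv : Module.End ℂ W) (μ : ℂ)).starProjection :
        W →ₗ[ℂ] W)

theorem norm_rotLin (A : W ≃ₗᵢ[ℂ] W) (t : ℝ) (x : W) : ‖rotLin A t x‖ = ‖x‖ := by
  have hO := orthogonalFamily_eigenspaces A
  have key : ∀ u : Module.End.Eigenvalues (A.toLinearEquiv : Module.End ℂ W) → ℂ,
      (∀ μ, ‖u μ‖ = 1) →
      ‖∑ μ, u μ • (Module.End.eigenspace (A.toLinearEquiv : Module.End ℂ W)
        (μ : ℂ)).starProjection x‖ ^ 2 =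
      ∑ μ : Module.End.Eigenvalues (A.toLinearEquiv : Module.End ℂ W),
        ‖(Module.End.eigenspace (A.toLinearEquiv : Module.End ℂ W)
          (μ : ℂ)).starProjection x‖ ^ 2 := by
    intro u hu
    have h := hO.norm_sum (fun μ => u μ • (⟨(Module.End.eigenspace
      (A.toLinearEquiv : Module.End ℂ W) (μ : ℂ)).starProjection x,
        Submodule.starProjection_apply_mem _ _⟩ :
      Module.End.eigenspace (A.toLinearEquiv : Module.End ℂ W) (μ : ℂ))) Finset.univ
    refine Eq.trans ?_ (h.trans ?_)
    · rfl
    · refine Finset.sum_congr rfl fun μ _ => ?_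
      rw [norm_smul, hu, one_mul]
      rfl
  have h1 := key (fun μ => rotScalar μ t) (fun μ => norm_rotScalar _ _)
  have h2 := key (fun _ => 1) (fun _ => norm_one)
  have h3 : ∑ μ : Module.End.Eigenvalues (A.toLinearEquiv : Module.End ℂ W),
      (1 : ℂ) • (Module.End.eigenspace (A.toLinearEquiv : Module.End ℂ W)
        (μ : ℂ)).starProjection x = x := by
    simp only [one_smul]
    exact hO.sum_projection_of_mem_iSup x (by rw [iSup_eigenspaces A]; trivial)
  rw [h3] at h2
  have h4 : rotLin A t x = ∑ μ : Module.End.Eigenvalues (A.toLinearEquiv : Module.End ℂ W),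
      rotScalar (μ : ℂ) t • (Module.End.eigenspace (A.toLinearEquiv : Module.End ℂ W)
        (μ : ℂ)).starProjection x := by
    simp [rotLin]
  rw [← sq_eq_sq₀ (norm_nonneg _) (norm_nonneg _), h4, h1, h2]

/-- The action of `t : ℝ` on the unitary space `W` with operator `A`, as an isometry. -/
def rot (A : W ≃ₗᵢ[ℂ] W) (t : ℝ) : W ≃ₗᵢ[ℂ] W :=
  LinearIsometry.toLinearIsometryEquiv ⟨rotLin A t, norm_rotLin A t⟩ rfl

theorem rot_apply_of_mem (A : W ≃ₗᵢ[ℂ] W) (t : ℝ) {μ : ℂ} {x : W} (hx : A x = μ • x) :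
    rot A t x = rotScalar μ t • x := by
  classical
  have hO := orthogonalFamily_eigenspaces A
  by_cases hx0 : x = 0
  · simp [hx0]
  have hmem : x ∈ Module.End.eigenspace (A.toLinearEquiv : Module.End ℂ W) μ :=
    Module.End.mem_eigenspace_iff.mpr hx
  have hev : Module.End.HasEigenvalue (A.toLinearEquiv : Module.End ℂ W) μ :=
    Module.End.hasEigenvalue_of_hasEigenvector ⟨hmem, hx0⟩
  change rotLin A t x = _
  simp only [rotLin, LinearMap.sum_apply, LinearMap.smul_apply]
  refine (Finset.sum_eq_single (⟨μ, hev⟩ : Module.End.Eigenvalues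
    (A.toLinearEquiv : Module.End ℂ W)) ?_ ?_).trans ?_
  rotate_left 2
  · congr 1
    exact Submodule.starProjection_eq_self_iff.mpr hmem
  · intro ν _ hne
    have : (Module.End.eigenspace (A.toLinearEquiv : Module.End ℂ W) (ν : ℂ)).starProjection x
        = 0 := by
      rw [Submodule.starProjection_apply_eq_zero_iff]
      intro y hy
      exact hO hne ⟨y, hy⟩ ⟨x, hmem⟩
    change rotScalar (ν : ℂ) t • (Module.End.eigenspace (A.toLinearEquiv : Module.End ℂ W)
      (ν : ℂ)).starProjection x = 0
    rw [this, smul_zero]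
  · intro h
    exact (h (Finset.mem_univ (α := Module.End.Eigenvalues
      (A.toLinearEquiv : Module.End ℂ W)) _)).elim

/-- An isometry intertwining `A` and `B` intertwines the two actions of `ℝ`. -/
theorem rot_comm {A : W ≃ₗᵢ[ℂ] W} {W' : Type*} [NormedAddCommGroup W'] [InnerProductSpace ℂ W']
    [FiniteDimensional ℂ W'] {B : W' ≃ₗᵢ[ℂ] W'} (C : W ≃ₗᵢ[ℂ] W')
    (h : ∀ x, C (A x) = B (C x)) (t : ℝ) (x : W) : C (rot A t x) = rot B t (C x) := by
  have hx : x ∈ ⨆ μ : Module.End.Eigenvalues (A.toLinearEquiv : Module.End ℂ W),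
      Module.End.eigenspace (A.toLinearEquiv : Module.End ℂ W) (μ : ℂ) := by
    rw [iSup_eigenspaces A]; trivial
  refine Submodule.iSup_induction _ (motive := fun x => C (rot A t x) = rot B t (C x)) hx ?_ ?_ ?_
  · intro μ x hx
    have hx' : A x = (μ : ℂ) • x := Module.End.mem_eigenspace_iff.mp hx
    rw [rot_apply_of_mem A t hx', rot_apply_of_mem B t (μ := μ) (by rw [← h, hx', map_smul]),
      map_smul]
  · simp
  · intro a b ha hb
    simp only [map_add, ha, hb]

end Rotation

/-! ### The symmetric powers of a Euclidean space -/

section Sym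

variable (n : ℕ) (V : Type*) [NormedAddCommGroup V] [InnerProductSpace ℝ V]

/-- The tensor power `V^{⊗ n}` of a Euclidean space; it is given the inner product
`⟪v₁ ⊗ ⋯ ⊗ vₙ, w₁ ⊗ ⋯ ⊗ wₙ⟫ = ∏ i, ⟪vᵢ, wᵢ⟫` below. -/
def TPow : Type _ := PiTensorProduct ℝ (fun _ : Fin n => V)

instance : AddCommGroup (TPow n V) :=
  inferInstanceAs (AddCommGroup (PiTensorProduct ℝ (fun _ : Fin n => V)))
instance : Module ℝ (TPow n V) :=
  inferInstanceAs (Module ℝ (PiTensorProduct ℝ (fun _ : Fin n => V)))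

variable {n V}

/-- The pure tensor `v₁ ⊗ ⋯ ⊗ vₙ`. -/
def TPow.tprod (v : Fin n → V) : TPow n V := PiTensorProduct.tprod ℝ v

theorem TPow.hom_ext {M : Type*} [AddCommGroup M] [Module ℝ M] {f g : TPow n V →ₗ[ℝ] M}
    (h : ∀ v, f (TPow.tprod v) = g (TPow.tprod v)) : f = g :=
  PiTensorProduct.ext (MultilinearMap.ext h)

/-- The functional `w₁ ⊗ ⋯ ⊗ wₙ ↦ ∏ i, ⟪vᵢ, wᵢ⟫`. -/
def TPow.formAux (v : Fin n → V) : TPow n V →ₗ[ℝ] ℝ :=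
  PiTensorProduct.lift
    ((MultilinearMap.mkPiAlgebra ℝ (Fin n) ℝ).compLinearMap (fun i => innerₗ V (v i)))

theorem TPow.formAux_tprod (v w : Fin n → V) :
    TPow.formAux v (TPow.tprod w) = ∏ i, inner ℝ (v i) (w i) := by
  refine (PiTensorProduct.lift.tprod _).trans ?_
  simp

/-- The bilinear form `⟪v₁ ⊗ ⋯ ⊗ vₙ, w₁ ⊗ ⋯ ⊗ wₙ⟫ = ∏ i, ⟪vᵢ, wᵢ⟫` on the tensor power. -/
def TPow.form : TPow n V →ₗ[ℝ] TPow n V →ₗ[ℝ] ℝ :=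
  PiTensorProduct.lift
    { toFun := TPow.formAux
      map_update_add' := by
        intro _ v i x y
        refine TPow.hom_ext fun w => ?_
        rw [LinearMap.add_apply]
        simp only [TPow.formAux_tprod]
        have h : ∀ (u : V) , ∀ j, inner ℝ (Function.update v i u j) (w j) =
            Function.update (fun j => inner ℝ (v j) (w j)) i (inner ℝ u (w i)) j := by
          intro u j
          by_cases hj : j = i
          · subst hj; simp
          · simp [hj]
        simp only [h, inner_add_left]
        rw [Finset.prod_update_of_mem (Finset.mem_univ _),
          Finset.prod_update_of_mem (Finset.mem_univ _),
          Finset.prod_update_of_mem (Finset.mem_univ _)]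
        ring
      map_update_smul' := by
        intro _ v i c x
        refine TPow.hom_ext fun w => ?_
        rw [LinearMap.smul_apply]
        simp only [TPow.formAux_tprod]
        have h : ∀ (u : V) , ∀ j, inner ℝ (Function.update v i u j) (w j) =
            Function.update (fun j => inner ℝ (v j) (w j)) i (inner ℝ u (w i)) j := by
          intro u j
          by_cases hj : j = i
          · subst hj; simp
          · simp [hj]
        simp only [h, real_inner_smul_left]
        rw [Finset.prod_update_of_mem (Finset.mem_univ _),
          Finset.prod_update_of_mem (Finset.mem_univ _), smul_eq_mul]
        ring }

theorem TPow.form_tprod (v w : Fin n → V) :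
    TPow.form (TPow.tprod v) (TPow.tprod w) = ∏ i, inner ℝ (v i) (w i) := by
  have : TPow.form (TPow.tprod v) = TPow.formAux v := PiTensorProduct.lift.tprod _
  rw [this, TPow.formAux_tprod]

theorem TPow.form_comm (x y : TPow n V) : TPow.form x y = TPow.form y x := by
  have : TPow.form (n := n) (V := V) = TPow.form.flip := by
    refine TPow.hom_ext fun v => TPow.hom_ext fun w => ?_
    rw [LinearMap.flip_apply, TPow.form_tprod, TPow.form_tprod]
    simp only [real_inner_comm]
  conv_lhs => rw [this]
  rfl

theorem TPow.form_self [FiniteDimensional ℝ V] (x : TPow n V) :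
    ∃ c : (Fin n → Fin (Module.finrank ℝ V)) → ℝ,
      TPow.form x x = ∑ p, c p ^ 2 ∧ (c = 0 → x = 0) := by
  classical
  let b := stdOrthonormalBasis ℝ V
  let B : Module.Basis (Fin n → Fin (Module.finrank ℝ V)) ℝ (TPow n V) :=
    Basis.piTensorProduct (fun _ : Fin n => b.toBasis)
  have hB : ∀ p, B p = TPow.tprod (fun i => b (p i)) := by
    intro p
    refine (Basis.piTensorProduct_apply _ p).trans ?_
    simp [TPow.tprod]
  have hBB : ∀ p q, TPow.form (B p) (B q) = if p = q then 1 else 0 := by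
    intro p q
    rw [hB, hB, TPow.form_tprod]
    have := orthonormal_iff_ite.mp b.orthonormal
    simp only [this, Finset.prod_ite_zero, Finset.prod_const_one]
    simp [funext_iff]
  refine ⟨B.repr x, ?_, ?_⟩
  · conv_lhs => rw [← B.sum_repr x]
    simp only [map_sum, LinearMap.sum_apply, map_smul, LinearMap.smul_apply, hBB, smul_eq_mul]
    simp [sq]
  · intro h
    apply B.repr.injective
    rw [map_zero]
    exact DFunLike.coe_injective h

/-- The inner product on the tensor power. -/
@[reducible] def TPow.core [FiniteDimensional ℝ V] : InnerProductSpace.Core ℝ (TPow n V) where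
  inner x y := TPow.form x y
  conj_inner_symm x y := TPow.form_comm y x
  re_inner_nonneg x := by
    obtain ⟨c, hc, -⟩ := TPow.form_self x
    change 0 ≤ TPow.form x x
    rw [hc]
    positivity
  add_left x y z := by simp
  smul_left x y r := by simp
  definite x h := by
    obtain ⟨c, hc, h0⟩ := TPow.form_self x
    apply h0
    change TPow.form x x = 0 at h
    rw [hc, Finset.sum_eq_zero_iff_of_nonneg (fun _ _ => by positivity)] at h
    funext p
    exact pow_eq_zero_iff (two_ne_zero) |>.mp (h p (Finset.mem_univ _))

instance [FiniteDimensional ℝ V] : NormedAddCommGroup (TPow n V) :=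
  (TPow.core (n := n) (V := V)).toNormedAddCommGroup
instance [FiniteDimensional ℝ V] : InnerProductSpace ℝ (TPow n V) :=
  InnerProductSpace.ofCore (TPow.core (n := n) (V := V)).toCore

theorem TPow.norm_sq [FiniteDimensional ℝ V] (x : TPow n V) : ‖x‖ ^ 2 = TPow.form x x :=
  (real_inner_self_eq_norm_sq x).symm

/-- The permutation action on the tensor power. -/
def TPow.perm (σ : Equiv.Perm (Fin n)) : TPow n V →ₗ[ℝ] TPow n V :=
  (PiTensorProduct.reindex ℝ (fun _ : Fin n => V) σ).toLinearMap

theorem TPow.perm_tprod (σ : Equiv.Perm (Fin n)) (v : Fin n → V) :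
    TPow.perm σ (TPow.tprod v) = TPow.tprod (fun i => v (σ.symm i)) :=
  PiTensorProduct.reindex_tprod σ v

/-- The diagonal action of an isometry on the tensor power. -/
def TPow.map {V' : Type*} [NormedAddCommGroup V'] [InnerProductSpace ℝ V'] (A : V ≃ₗᵢ[ℝ] V') :
    TPow n V →ₗ[ℝ] TPow n V' :=
  PiTensorProduct.map (fun _ => A.toLinearEquiv.toLinearMap)

theorem TPow.map_tprod {V' : Type*} [NormedAddCommGroup V'] [InnerProductSpace ℝ V']
    (A : V ≃ₗᵢ[ℝ] V') (v : Fin n → V) :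
    TPow.map A (TPow.tprod v) = TPow.tprod (fun i => A (v i)) :=
  PiTensorProduct.map_tprod _ _

variable {V' V'' : Type*} [NormedAddCommGroup V'] [InnerProductSpace ℝ V']
  [NormedAddCommGroup V''] [InnerProductSpace ℝ V'']

theorem TPow.map_map (A : V' ≃ₗᵢ[ℝ] V'') (B : V ≃ₗᵢ[ℝ] V') (x : TPow n V) :
    TPow.map A (TPow.map B x) = TPow.map (B.trans A) x := by
  have : (TPow.map A (n := n)) ∘ₗ TPow.map B = TPow.map (B.trans A) :=
    TPow.hom_ext fun v => by simp [TPow.map_tprod]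
  exact LinearMap.congr_fun this x

theorem TPow.map_refl (x : TPow n V) : TPow.map (LinearIsometryEquiv.refl ℝ V) x = x := by
  have : (TPow.map (LinearIsometryEquiv.refl ℝ V) (n := n)) = LinearMap.id :=
    TPow.hom_ext fun v => by simp [TPow.map_tprod]
  exact LinearMap.congr_fun this x

theorem TPow.map_perm (A : V ≃ₗᵢ[ℝ] V') (σ : Equiv.Perm (Fin n)) (x : TPow n V) :
    TPow.perm σ (TPow.map A x) = TPow.map A (TPow.perm σ x) := by
  have : (TPow.perm σ) ∘ₗ (TPow.map A (n := n)) = TPow.map A ∘ₗ TPow.perm σ :=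
    TPow.hom_ext fun v => by simp [TPow.map_tprod, TPow.perm_tprod]
  exact LinearMap.congr_fun this x

theorem TPow.norm_map [FiniteDimensional ℝ V] [FiniteDimensional ℝ V'] (A : V ≃ₗᵢ[ℝ] V')
    (x : TPow n V) : ‖TPow.map A x‖ = ‖x‖ := by
  have h : (TPow.form (n := n) (V := V')).compl₁₂ (TPow.map A) (TPow.map A) = TPow.form := by
    refine TPow.hom_ext fun v => TPow.hom_ext fun w => ?_
    simp [TPow.map_tprod, TPow.form_tprod]
  rw [← sq_eq_sq₀ (norm_nonneg _) (norm_nonneg _), TPow.norm_sq, TPow.norm_sq]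
  exact LinearMap.congr_fun (LinearMap.congr_fun h x) x

variable (V) in
/-- The symmetric algebra `Sym(V) = ⨁ₙ Symⁿ(V)` as an inner product space. Its elements are the
finitely supported families of symmetric tensors; it carries the norm `‖b‖² = ∑ₙ ‖bₙ‖²`. -/
def SymAlg [FiniteDimensional ℝ V] : Submodule ℝ (lp (fun n => TPow n V) 2) where
  carrier := {b | {n | b.1 n ≠ 0}.Finite ∧
    ∀ n (σ : Equiv.Perm (Fin n)), TPow.perm σ (b.1 n) = b.1 n}
  add_mem' := by
    rintro a b ⟨ha, ha'⟩ ⟨hb, hb'⟩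
    refine ⟨(ha.union hb).subset ?_, fun n σ => ?_⟩
    · intro n hn
      by_contra h
      simp only [Set.mem_union, Set.mem_ofPred_eq, not_or, not_not] at h
      exact hn ((congrArg₂ (· + ·) h.1 h.2).trans (add_zero _))
    · exact (_root_.map_add (TPow.perm σ) (a.1 n) (b.1 n)).trans
        (congrArg₂ (· + ·) (ha' n σ) (hb' n σ))
  zero_mem' := by
    refine ⟨?_, fun n σ => _root_.map_zero (TPow.perm σ)⟩
    have : {n | (0 : lp (fun n => TPow n V) 2).1 n ≠ 0} = ∅ := by
      ext n
      simp
    rw [this]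
    exact Set.finite_empty
  smul_mem' := by
    rintro c b ⟨hb, hb'⟩
    refine ⟨hb.subset fun n hn h => hn ?_, fun n σ => ?_⟩
    · exact (congrArg (c • ·) h).trans (smul_zero _)
    · exact (_root_.map_smul (TPow.perm σ) c (b.1 n)).trans (congrArg (c • ·) (hb' n σ))

theorem SymAlg.memℓp [FiniteDimensional ℝ V] [FiniteDimensional ℝ V'] (A : V ≃ₗᵢ[ℝ] V')
    (b : SymAlg V) : Memℓp (fun n => TPow.map A (b.1.1 n)) 2 := by
  have h := lp.memℓp b.1
  rw [memℓp_gen_iff (by norm_num)] at h ⊢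
  refine h.congr fun n => ?_
  rw [TPow.norm_map]

/-- The action of an isometry on the symmetric algebra. -/
def SymAlg.map [FiniteDimensional ℝ V] [FiniteDimensional ℝ V'] (A : V ≃ₗᵢ[ℝ] V')
    (b : SymAlg V) : SymAlg V' :=
  ⟨(⟨fun n => TPow.map A (b.1.1 n), SymAlg.memℓp A b⟩ : lp (fun n => TPow n V') 2), by
    refine ⟨b.2.1.subset ?_, ?_⟩
    · intro n hn h
      have h' : b.1.1 n = 0 := h
      exact hn (by
        change TPow.map A (b.1.1 n) = 0
        rw [h', map_zero])
    · intro n σ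
      change TPow.perm σ (TPow.map A (b.1.1 n)) = TPow.map A (b.1.1 n)
      rw [TPow.map_perm]
      exact congrArg (TPow.map A) (b.2.2 n σ)⟩

theorem SymAlg.norm_map [FiniteDimensional ℝ V] [FiniteDimensional ℝ V'] (A : V ≃ₗᵢ[ℝ] V')
    (b : SymAlg V) : ‖SymAlg.map A b‖ = ‖b‖ := by
  have h : ∀ n, ‖(SymAlg.map A b).1.1 n‖ = ‖b.1.1 n‖ := fun n => TPow.norm_map A (b.1.1 n)
  change ‖(SymAlg.map A b).1‖ = ‖b.1‖
  rw [lp.norm_eq_tsum_rpow (by norm_num), lp.norm_eq_tsum_rpow (by norm_num)]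
  simp only [h]

theorem SymAlg.map_sub [FiniteDimensional ℝ V] [FiniteDimensional ℝ V'] (A : V ≃ₗᵢ[ℝ] V')
    (b c : SymAlg V) : SymAlg.map A (b - c) = SymAlg.map A b - SymAlg.map A c := by
  apply Subtype.ext
  apply lp.ext
  funext n
  exact _root_.map_sub (TPow.map A) (b.1.1 n) (c.1.1 n)

theorem SymAlg.continuous_map [FiniteDimensional ℝ V] [FiniteDimensional ℝ V']
    (A : V ≃ₗᵢ[ℝ] V') : Continuous (SymAlg.map A) := by
  refine (Isometry.of_dist_eq fun b c => ?_).continuous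
  rw [dist_eq_norm, dist_eq_norm, ← SymAlg.map_sub, SymAlg.norm_map]

theorem SymAlg.map_map [FiniteDimensional ℝ V] [FiniteDimensional ℝ V'] [FiniteDimensional ℝ V'']
    (A : V' ≃ₗᵢ[ℝ] V'') (B : V ≃ₗᵢ[ℝ] V') (b : SymAlg V) :
    SymAlg.map A (SymAlg.map B b) = SymAlg.map (B.trans A) b := by
  apply Subtype.ext
  apply lp.ext
  funext n
  exact TPow.map_map A B (b.1.1 n)

end Sym

/-! ### Functors on Euclidean spaces -/

/-- The topology on the space of linear isometric isomorphisms, induced from the space of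
continuous linear maps. -/
instance isoTopology {W W' : Type*} [NormedAddCommGroup W] [InnerProductSpace ℝ W]
    [NormedAddCommGroup W'] [InnerProductSpace ℝ W'] : TopologicalSpace (W ≃ₗᵢ[ℝ] W') :=
  TopologicalSpace.induced (fun A => (A.toLinearIsometry.toContinuousLinearMap : W →L[ℝ] W'))
    inferInstance

/-- A continuous functor from the category of finite-dimensional real inner product spaces and
linear isometric isomorphisms to the category of based spaces. Every orthogonal spectrum `E` has
such an underlying functor `W ↦ E(W)`. -/
structure IsoFunctor where
  /-- The value `E(W)`. -/
  obj : ∀ (W : Type u) [NormedAddCommGroup W] [InnerProductSpace ℝ W] [FiniteDimensional ℝ W],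
    Type w
  [top : ∀ (W : Type u) [NormedAddCommGroup W] [InnerProductSpace ℝ W] [FiniteDimensional ℝ W],
    TopologicalSpace (obj W)]
  /-- The base point of `E(W)`. -/
  pt : ∀ (W : Type u) [NormedAddCommGroup W] [InnerProductSpace ℝ W] [FiniteDimensional ℝ W],
    obj W
  /-- The map `E(A) : E(W) → E(W')`. -/
  map : ∀ {W W' : Type u} [NormedAddCommGroup W] [InnerProductSpace ℝ W] [FiniteDimensional ℝ W]
    [NormedAddCommGroup W'] [InnerProductSpace ℝ W'] [FiniteDimensional ℝ W'],
    (W ≃ₗᵢ[ℝ] W') → C(obj W, obj W')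
  map_pt : ∀ {W W' : Type u} [NormedAddCommGroup W] [InnerProductSpace ℝ W]
    [FiniteDimensional ℝ W] [NormedAddCommGroup W'] [InnerProductSpace ℝ W']
    [FiniteDimensional ℝ W'] (A : W ≃ₗᵢ[ℝ] W'), map A (pt W) = pt W'
  map_refl : ∀ {W : Type u} [NormedAddCommGroup W] [InnerProductSpace ℝ W]
    [FiniteDimensional ℝ W] (x : obj W), map (LinearIsometryEquiv.refl ℝ W) x = x
  map_trans : ∀ {W W' W'' : Type u} [NormedAddCommGroup W] [InnerProductSpace ℝ W]
    [FiniteDimensional ℝ W] [NormedAddCommGroup W'] [InnerProductSpace ℝ W']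
    [FiniteDimensional ℝ W'] [NormedAddCommGroup W''] [InnerProductSpace ℝ W'']
    [FiniteDimensional ℝ W''] (A : W ≃ₗᵢ[ℝ] W') (B : W' ≃ₗᵢ[ℝ] W'') (x : obj W),
    map (A.trans B) x = map B (map A x)
  continuous_map : ∀ {W W' : Type u} [NormedAddCommGroup W] [InnerProductSpace ℝ W]
    [FiniteDimensional ℝ W] [NormedAddCommGroup W'] [InnerProductSpace ℝ W']
    [FiniteDimensional ℝ W'],
    Continuous (fun p : (W ≃ₗᵢ[ℝ] W') × obj W => map p.1 p.2)

attribute [instance] IsoFunctor.top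

/-! ### Orthogonal representations -/

/-- An orthogonal representation of `G` on the real inner product space `V`. -/
structure OrthRep (G : Type*) [Group G] [TopologicalSpace G] (V : Type*) [NormedAddCommGroup V]
    [InnerProductSpace ℝ V] where
  /-- The action by linear isometries. -/
  toHom : G →* (V ≃ₗᵢ[ℝ] V)
  continuous_action : Continuous (fun p : G × V => toHom p.1 p.2)

variable {G : Type*} [Group G] [TopologicalSpace G] {H : Type*} [Group H] [TopologicalSpace H]
variable {V : Type u} [NormedAddCommGroup V] [InnerProductSpace ℝ V]

/-- The restriction of a representation along a continuous homomorphism. -/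
def OrthRep.res (ρ : OrthRep G V) (φ : H →ₜ* G) : OrthRep H V where
  toHom := ρ.toHom.comp φ.toMonoidHom
  continuous_action :=
    ρ.continuous_action.comp ((φ.continuous_toFun.comp continuous_fst).prodMk continuous_snd)

/-- The fixed space `V^g`. -/
def fixedSpace (ρ : OrthRep G V) (g : G) : Submodule ℝ V where
  carrier := {v | ρ.toHom g v = v}
  add_mem' := fun {a b} ha hb => (map_add _ a b).trans (congrArg₂ (· + ·) ha hb)
  zero_mem' := map_zero _
  smul_mem' := fun c a ha => (map_smul _ c a).trans (congrArg (c • ·) ha)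

theorem OrthRep.apply_mul (ρ : OrthRep G V) (x y : G) (v : V) :
    ρ.toHom (x * y) v = ρ.toHom x (ρ.toHom y v) := by
  rw [map_mul]; rfl

theorem OrthRep.apply_comm (ρ : OrthRep G V) {x g g' : G} (h : x * g = g' * x) (v : V) :
    ρ.toHom x (ρ.toHom g v) = ρ.toHom g' (ρ.toHom x v) := by
  rw [← ρ.apply_mul, h, ρ.apply_mul]

/-- If `x g = g' x`, then `x` maps `V^g` isometrically onto `V^{g'}`. -/
def fixedSpace.conj (ρ : OrthRep G V) {x g g' : G} (h : x * g = g' * x) :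
    fixedSpace ρ g ≃ₗᵢ[ℝ] fixedSpace ρ g' where
  toFun v := ⟨ρ.toHom x v.1, (ρ.apply_comm h v.1).symm.trans (congrArg (ρ.toHom x) v.2)⟩
  invFun v := ⟨ρ.toHom x⁻¹ v.1, by
    have h' : x⁻¹ * g' = g * x⁻¹ := by
      rw [inv_mul_eq_iff_eq_mul, ← mul_assoc, h, mul_inv_cancel_right]
    exact (ρ.apply_comm h' v.1).symm.trans (congrArg (ρ.toHom x⁻¹) v.2)⟩
  map_add' a b := Subtype.ext (map_add (ρ.toHom x) a.1 b.1)
  map_smul' c a := Subtype.ext (map_smul (ρ.toHom x) c a.1)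
  left_inv v := Subtype.ext (by
    change ρ.toHom x⁻¹ (ρ.toHom x v.1) = v.1
    rw [← ρ.apply_mul, inv_mul_cancel, map_one]; rfl)
  right_inv v := Subtype.ext (by
    change ρ.toHom x (ρ.toHom x⁻¹ v.1) = v.1
    rw [← ρ.apply_mul, mul_inv_cancel, map_one]; rfl)
  norm_map' v := (ρ.toHom x).norm_map v.1

theorem Cx.map_comm (ρ : OrthRep G V) {x g g' : G} (h : x * g = g' * x) (z : Cx V) :
    Cx.map (ρ.toHom x) (Cx.map (ρ.toHom g) z) = Cx.map (ρ.toHom g') (Cx.map (ρ.toHom x) z) := by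
  have key : ∀ z : ℂ ⊗[ℝ] V,
      TensorProduct.map LinearMap.id (ρ.toHom x).toLinearEquiv.toLinearMap
        (TensorProduct.map LinearMap.id (ρ.toHom g).toLinearEquiv.toLinearMap z) =
      TensorProduct.map LinearMap.id (ρ.toHom g').toLinearEquiv.toLinearMap
        (TensorProduct.map LinearMap.id (ρ.toHom x).toLinearEquiv.toLinearMap z) := by
    intro z
    induction z using TensorProduct.induction_on with
    | zero => simp
    | tmul a v => 
      simp only [TensorProduct.map_tmul]
      exact congrArg (a ⊗ₜ[ℝ] ·) (ρ.apply_comm h v)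
    | add a b ha hb => simp only [map_add, ha, hb]
  exact key z

theorem Cx.map_mul (ρ : OrthRep G V) (x y : G) (z : Cx V) :
    Cx.map (ρ.toHom (x * y)) z = Cx.map (ρ.toHom x) (Cx.map (ρ.toHom y) z) := by
  have key : ∀ z : ℂ ⊗[ℝ] V,
      TensorProduct.map LinearMap.id (ρ.toHom (x * y)).toLinearEquiv.toLinearMap z =
      TensorProduct.map LinearMap.id (ρ.toHom x).toLinearEquiv.toLinearMap
        (TensorProduct.map LinearMap.id (ρ.toHom y).toLinearEquiv.toLinearMap z) := by
    intro z
    induction z using TensorProduct.induction_on with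
    | zero => simp
    | tmul a v => 
      simp only [TensorProduct.map_tmul]
      exact congrArg (a ⊗ₜ[ℝ] ·) (ρ.apply_mul x y v)
    | add a b ha hb => simp only [map_add, ha, hb]
  exact key z

variable [FiniteDimensional ℝ V]

/-! ### The real representation `(V)^ℝ_g = (V ⊗ ℂ)_g ⊕ (V ⊗ ℂ)_g^*` -/

/-- The dual `f ↦ f ∘ C⁻¹` of a unitary map `C`. -/
def CxDual.map (C : Cx V ≃ₗᵢ[ℂ] Cx V) : CxDual V ≃ₗᵢ[ℝ] CxDual V where
  toFun f := f.comp (C.symm.toLinearIsometry.toContinuousLinearMap)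
  invFun f := f.comp (C.toLinearIsometry.toContinuousLinearMap)
  map_add' f h := rfl
  map_smul' r f := rfl
  left_inv f := by ext x; simp
  right_inv f := by ext x; simp
  norm_map' f := ContinuousLinearMap.opNorm_comp_linearIsometryEquiv f C.symm

/-- The orthogonal direct sum of two inner product spaces. -/
def DSum (W W' : Type*) : Type _ := WithLp 2 (W × W')

section DSum

variable {W W' : Type*} [NormedAddCommGroup W] [InnerProductSpace ℝ W]
  [NormedAddCommGroup W'] [InnerProductSpace ℝ W']
  {U U' : Type*} [NormedAddCommGroup U] [InnerProductSpace ℝ U]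
  [NormedAddCommGroup U'] [InnerProductSpace ℝ U']

instance : NormedAddCommGroup (DSum W W') :=
  inferInstanceAs (NormedAddCommGroup (WithLp 2 (W × W')))
instance : InnerProductSpace ℝ (DSum W W') :=
  inferInstanceAs (InnerProductSpace ℝ (WithLp 2 (W × W')))
instance [FiniteDimensional ℝ W] [FiniteDimensional ℝ W'] : FiniteDimensional ℝ (DSum W W') :=
  inferInstanceAs (FiniteDimensional ℝ (WithLp 2 (W × W')))

/-- The direct sum of two isometries. -/
def DSum.map (A : W ≃ₗᵢ[ℝ] U) (B : W' ≃ₗᵢ[ℝ] U') : DSum W W' ≃ₗᵢ[ℝ] DSum U U' :=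
  LinearIsometryEquiv.withLpProdCongr 2 A B

/-- The first component. -/
def DSum.fst (z : DSum W W') : W := WithLp.fst (p := 2) (α := W) (β := W') z

/-- The second component. -/
def DSum.snd (z : DSum W W') : W' := WithLp.snd (p := 2) (α := W) (β := W') z

theorem DSum.ext {y z : DSum W W'} (h : y.fst = z.fst) (h' : y.snd = z.snd) : y = z :=
  (WithLp.equiv 2 (W × W')).injective (Prod.ext h h')

end DSum

variable (V) in
/-- The real inner product space underlying `(V ⊗ ℂ) ⊕ (V ⊗ ℂ)^*`; this is the underlying space
of `(V)^ℝ_g` for every `g`. -/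
abbrev VR : Type u := DSum (Cx V) (CxDual V)

/-- The unitary map `C` acting on `(V ⊗ ℂ) ⊕ (V ⊗ ℂ)^*`. -/
def VR.map (C : Cx V ≃ₗᵢ[ℂ] Cx V) : VR V ≃ₗᵢ[ℝ] VR V :=
  DSum.map
    ({ toLinearEquiv := C.toLinearEquiv.restrictScalars ℝ
       norm_map' := C.norm_map } : Cx V ≃ₗᵢ[ℝ] Cx V) (CxDual.map C)

/-- The action of `[1, t]`, `t : ℝ`, on `(V)^ℝ_g`. -/
def rotVR (ρ : OrthRep G V) (g : G) (t : ℝ) : VR V ≃ₗᵢ[ℝ] VR V :=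
  VR.map (rot (Cx.map (ρ.toHom g)) t)

/-- The underlying space of `(V)^ℝ_g ⊕ V^g`. -/
abbrev EV (ρ : OrthRep G V) (g : G) : Type u := DSum (VR V) (fixedSpace ρ g)

/-- The action of `[1, t]`, `t : ℝ`, on `(V)^ℝ_g ⊕ V^g`, trivial on the second summand. -/
def rotEV (ρ : OrthRep G V) (g : G) (t : ℝ) : EV ρ g ≃ₗᵢ[ℝ] EV ρ g :=
  DSum.map (rotVR ρ g t) (LinearIsometryEquiv.refl ℝ _)

/-- The action of `x` as a map `(V)^ℝ_g → (V)^ℝ_{g'}`, where `x g = g' x`. -/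
def conjVR (ρ : OrthRep G V) (x : G) : VR V ≃ₗᵢ[ℝ] VR V :=
  VR.map (Cx.map (ρ.toHom x))

/-- The action of `x` as a map `(V)^ℝ_g ⊕ V^g → (V)^ℝ_{g'} ⊕ V^{g'}`, where `x g = g' x`. -/
def conjEV (ρ : OrthRep G V) {x g g' : G} (h : x * g = g' * x) : EV ρ g ≃ₗᵢ[ℝ] EV ρ g' :=
  DSum.map (conjVR ρ x) (fixedSpace.conj ρ h)

/-- The isomorphism `a_τ : (V)^ℝ_{φ(τ)} ⊕ V^{φ(τ)} → (V)^ℝ_τ ⊕ V^τ` sending `v` to `v`. -/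
def aIso (ρ : OrthRep G V) (φ : H →ₜ* G) (τ : H) : EV ρ (φ τ) ≃ₗᵢ[ℝ] EV (ρ.res φ) τ :=
  DSum.map (LinearIsometryEquiv.refl ℝ (VR V))
    (LinearIsometryEquiv.ofEq (fixedSpace ρ (φ τ)) (fixedSpace (ρ.res φ) τ) rfl)

theorem VR.map_map (C D K : Cx V ≃ₗᵢ[ℂ] Cx V) (h : ∀ z, C (D z) = K z) (z : VR V) :
    VR.map C (VR.map D z) = VR.map K z := by
  have hs : ∀ z, D.symm (C.symm z) = K.symm z := by
    intro z
    rw [LinearIsometryEquiv.eq_symm_apply, ← h]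
    simp
  apply DSum.ext
  · exact h z.fst
  · apply ContinuousLinearMap.ext
    intro w
    exact congrArg z.snd (hs w)

theorem VR.map_comm (C D C' D' : Cx V ≃ₗᵢ[ℂ] Cx V) (h : ∀ z, C (D z) = C' (D' z)) (z : VR V) :
    VR.map C (VR.map D z) = VR.map C' (VR.map D' z) :=
  (VR.map_map C D (D'.trans C') h z).trans (VR.map_map C' D' (D'.trans C') (fun _ => rfl) z).symm

theorem conjVR_rotVR (ρ : OrthRep G V) {x g g' : G} (h : x * g = g' * x) (t : ℝ) (z : VR V) :
    conjVR ρ x (rotVR ρ g t z) = rotVR ρ g' t (conjVR ρ x z) :=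
  VR.map_comm _ _ _ _ (rot_comm _ (Cx.map_comm ρ h) t) z

theorem conjVR_mul (ρ : OrthRep G V) (x y : G) (z : VR V) :
    conjVR ρ (x * y) z = conjVR ρ x (conjVR ρ y z) :=
  (VR.map_map _ _ _ (fun z => (Cx.map_mul ρ x y z).symm) z).symm

theorem conjEV_rotEV (ρ : OrthRep G V) {x g g' : G} (h : x * g = g' * x) (t : ℝ) :
    (rotEV ρ g t).trans (conjEV ρ h) = (conjEV ρ h).trans (rotEV ρ g' t) := by
  ext z
  exact DSum.ext (conjVR_rotVR ρ h t z.fst) rfl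

theorem conjEV_mul (ρ : OrthRep G V) {x y g g' g'' : G} (h : y * g = g' * y)
    (h' : x * g' = g'' * x) (h'' : (x * y) * g = g'' * (x * y)) :
    conjEV ρ h'' = (conjEV ρ h).trans (conjEV ρ h') := by
  ext z
  exact DSum.ext (conjVR_mul ρ x y z.fst) (Subtype.ext (ρ.apply_mul x y z.snd.1))

/-! ### The spaces `F_g(G, V)` and `S(G, V)_g` -/

/-- The map `S^W → S^{W'}` of one-point compactifications induced by an isometry. -/
def sphereMap {W W' : Type*} [NormedAddCommGroup W] [InnerProductSpace ℝ W]
    [NormedAddCommGroup W'] [InnerProductSpace ℝ W'] (A : W ≃ₗᵢ[ℝ] W') :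
    C(OnePoint W, OnePoint W') :=
  ⟨OnePoint.map A, A.toHomeomorph.onePointCongr.continuous⟩

theorem sphereMap_sphereMap {W W' W'' : Type*} [NormedAddCommGroup W] [InnerProductSpace ℝ W]
    [NormedAddCommGroup W'] [InnerProductSpace ℝ W'] [NormedAddCommGroup W'']
    [InnerProductSpace ℝ W''] (A : W ≃ₗᵢ[ℝ] W') (B : W' ≃ₗᵢ[ℝ] W'') (z : OnePoint W) :
    sphereMap B (sphereMap A z) = sphereMap (A.trans B) z := by
  induction z using OnePoint.rec <;> rfl

variable (E : IsoFunctor.{u, w})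

/-- `F_g(G, V) = Map_ℝ(S^{(V)^ℝ_g}, E((V)^ℝ_g ⊕ V^g))`, the space of based `ℝ`-equivariant maps. -/
def Fsp (ρ : OrthRep G V) (g : G) : Type _ :=
  {β : C(OnePoint (VR V), E.obj (EV ρ g)) //
    β OnePoint.infty = E.pt (EV ρ g) ∧
    ∀ (t : ℝ) (z : OnePoint (VR V)),
      β (sphereMap (rotVR ρ g t) z) = E.map (rotEV ρ g t) (β z)}

instance (ρ : OrthRep G V) (g : G) : TopologicalSpace (Fsp E ρ g) :=
  inferInstanceAs (TopologicalSpace (Subtype _))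

/-- The base point of `F_g(G, V)`: the constant map to the base point. -/
def Fsp.pt (ρ : OrthRep G V) (g : G) : Fsp E ρ g :=
  ⟨ContinuousMap.const _ (E.pt _), rfl, fun _ _ => (E.map_pt _).symm⟩

variable {E}

/-- For `x g = g' x`, the action `β ↦ E(x) ∘ β ∘ S(x⁻¹)` of `x` as a map
`F_g(G, V) → F_{g'}(G, V)`. -/
def Fsp.conj (ρ : OrthRep G V) {x g g' : G} (h : x * g = g' * x) :
    C(Fsp E ρ g, Fsp E ρ g') where
  toFun β := ⟨((E.map (conjEV ρ h)).comp β.1).comp (sphereMap (conjVR ρ x).symm), by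
    refine ⟨?_, fun t z => ?_⟩
    · change E.map (conjEV ρ h) (β.1 OnePoint.infty) = _
      rw [β.2.1, E.map_pt]
    · change E.map (conjEV ρ h) (β.1 (sphereMap (conjVR ρ x).symm (sphereMap (rotVR ρ g' t) z))) =
        E.map (rotEV ρ g' t) (E.map (conjEV ρ h) (β.1 (sphereMap (conjVR ρ x).symm z)))
      have h1 : sphereMap (conjVR ρ x).symm (sphereMap (rotVR ρ g' t) z) =
          sphereMap (rotVR ρ g t) (sphereMap (conjVR ρ x).symm z) := by
        rw [sphereMap_sphereMap, sphereMap_sphereMap]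
        congr 2
        ext y
        change (conjVR ρ x).symm (rotVR ρ g' t y) = rotVR ρ g t ((conjVR ρ x).symm y)
        rw [LinearIsometryEquiv.symm_apply_eq, conjVR_rotVR ρ h]
        simp
      rw [h1, β.2.2, ← E.map_trans, ← E.map_trans, conjEV_rotEV]⟩
  continuous_toFun := by
    refine Continuous.subtype_mk ?_ _
    exact (ContinuousMap.continuous_precomp _).comp
      ((ContinuousMap.continuous_postcomp _).comp continuous_subtype_val)

/-- The restriction map `F_{φ(τ)}(G, V) → F_τ(H, V)`, `β ↦ E(a_τ) ∘ β`. -/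
def Fsp.res (ρ : OrthRep G V) (φ : H →ₜ* G) (τ : H) :
    C(Fsp E ρ (φ τ), Fsp E (ρ.res φ) τ) where
  toFun β := ⟨(E.map (aIso ρ φ τ)).comp β.1, by
    refine ⟨?_, fun t z => ?_⟩
    · change E.map (aIso ρ φ τ) (β.1 OnePoint.infty) = _
      rw [β.2.1, E.map_pt]
    · change E.map (aIso ρ φ τ) (β.1 (sphereMap (rotVR ρ (φ τ) t) z)) =
        E.map (rotEV (ρ.res φ) τ t) (E.map (aIso ρ φ τ) (β.1 z))
      rw [β.2.2, ← E.map_trans, ← E.map_trans]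
      rfl⟩
  continuous_toFun := by
    refine Continuous.subtype_mk ?_ _
    exact (ContinuousMap.continuous_postcomp _).comp continuous_subtype_val

theorem Fsp.conj_pt (ρ : OrthRep G V) {x g g' : G} (h : x * g = g' * x) :
    Fsp.conj ρ h (Fsp.pt E ρ g) = Fsp.pt E ρ g' :=
  Subtype.ext (ContinuousMap.ext fun _ => E.map_pt _)

theorem Fsp.res_pt (ρ : OrthRep G V) (φ : H →ₜ* G) (τ : H) :
    Fsp.res ρ φ τ (Fsp.pt E ρ (φ τ)) = Fsp.pt E (ρ.res φ) τ :=
  Subtype.ext (ContinuousMap.ext fun _ => E.map_pt _)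

theorem Fsp.conj_mul (ρ : OrthRep G V) {x y g g' g'' : G} (h : y * g = g' * y)
    (h' : x * g' = g'' * x) (h'' : (x * y) * g = g'' * (x * y)) (β : Fsp E ρ g) :
    Fsp.conj ρ h'' β = Fsp.conj ρ h' (Fsp.conj ρ h β) := by
  refine Subtype.ext (ContinuousMap.ext fun z => ?_)
  change E.map (conjEV ρ h'') (β.1 (sphereMap (conjVR ρ (x * y)).symm z)) =
    E.map (conjEV ρ h') (E.map (conjEV ρ h)
      (β.1 (sphereMap (conjVR ρ y).symm (sphereMap (conjVR ρ x).symm z))))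
  rw [← E.map_trans, ← conjEV_mul ρ h h' h'', sphereMap_sphereMap]
  congr 4
  ext w
  change (conjVR ρ (x * y)).symm w = (conjVR ρ y).symm ((conjVR ρ x).symm w)
  rw [LinearIsometryEquiv.symm_apply_eq, conjVR_mul]
  simp

theorem Fsp.res_conj (ρ : OrthRep G V) (φ : H →ₜ* G) {x τ τ' : H} (h : x * τ = τ' * x)
    (h' : φ x * φ τ = φ τ' * φ x) (β : Fsp E ρ (φ τ)) :
    Fsp.res ρ φ τ' (Fsp.conj ρ h' β) = Fsp.conj (ρ.res φ) h (Fsp.res ρ φ τ β) := by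
  refine Subtype.ext (ContinuousMap.ext fun z => ?_)
  change E.map (aIso ρ φ τ') (E.map (conjEV ρ h') (β.1 (sphereMap (conjVR ρ (φ x)).symm z))) =
    E.map (conjEV (ρ.res φ) h) (E.map (aIso ρ φ τ)
      (β.1 (sphereMap (conjVR (ρ.res φ) x).symm z)))
  rw [← E.map_trans, ← E.map_trans]
  have e : (conjEV ρ h').trans (aIso ρ φ τ') = (aIso ρ φ τ).trans (conjEV (ρ.res φ) h) := by
    ext z
    rfl
  rw [e]
  rfl

/-- `S(G, V)_g = Sym(V) ∖ Sym(V)^g`. -/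
def Ssp (ρ : OrthRep G V) (g : G) : Set (SymAlg V) :=
  {b | SymAlg.map (ρ.toHom g) b ≠ b}

/-- The action of `x` on `Sym(V)`. -/
def symConj (ρ : OrthRep G V) (x : G) : C(SymAlg V, SymAlg V) :=
  ⟨SymAlg.map (ρ.toHom x), SymAlg.continuous_map _⟩

theorem symConj_mul (ρ : OrthRep G V) (x y : G) (b : SymAlg V) :
    symConj ρ (x * y) b = symConj ρ x (symConj ρ y b) := by
  change SymAlg.map _ b = SymAlg.map _ (SymAlg.map _ b)
  rw [SymAlg.map_map, map_mul]
  rfl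

theorem symConj_injective (ρ : OrthRep G V) (x : G) : Function.Injective (symConj ρ x) := by
  intro b c h
  have h' : SymAlg.map (ρ.toHom x) (b - c) = 0 := by
    rw [SymAlg.map_sub]; exact sub_eq_zero.mpr h
  have h'' : ‖b - c‖ = 0 := by rw [← SymAlg.norm_map (ρ.toHom x), h', norm_zero]
  exact sub_eq_zero.mp (norm_eq_zero.mp h'')

theorem symConj_mem (ρ : OrthRep G V) {x g g' : G} (h : x * g = g' * x) {b : SymAlg V}
    (hb : b ∈ Ssp ρ g) : symConj ρ x b ∈ Ssp ρ g' := by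
  intro h0
  apply hb
  apply symConj_injective ρ x
  change symConj ρ x (symConj ρ g b) = _
  rw [← symConj_mul, h, symConj_mul]
  exact h0

/-! ### The space `QE_g(G, V)` -/

section Join

variable {F : Type*} (c₀ : F) {Y : Type*} [NormedAddCommGroup Y] (S : Set Y)

/-- The set of formal combinations `(1 - t) a + t b` with `‖b‖ ≤ t`, in coordinates `(a, b, t)`.
The end `t = 0` consists of the points `(a, 0, 0)`. -/
def JoinPre (F : Type*) {Y : Type*} [NormedAddCommGroup Y] (S : Set Y) : Type _ :=
  {p : F × Y × unitInterval // ‖p.2.1‖ ≤ (p.2.2 : ℝ) ∧ (p.2.2 ≠ 0 → p.2.1 ∈ S)}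

instance [TopologicalSpace F] : TopologicalSpace (JoinPre F S) :=
  inferInstanceAs (TopologicalSpace (Subtype _))

/-- The points `(c₀, b, t)` and `(a, b, 1)`. As `(a, b, 1)` and `(c₀, b, 1)` are the same point
of the join, all these points are collapsed to the base point. -/
def JoinPre.Collapsed (p : JoinPre F S) : Prop := p.1.1 = c₀ ∨ p.1.2.2 = 1

/-- The equivalence relation collapsing the points `(c₀, b, t)` and `(a, b, 1)` to one point. -/
def joinSetoid : Setoid (JoinPre F S) where
  r p q := p = q ∨ (p.Collapsed c₀ ∧ q.Collapsed c₀)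
  iseqv := by
    refine ⟨fun p => Or.inl rfl, ?_, ?_⟩
    · rintro p q (h | h)
      · exact Or.inl h.symm
      · exact Or.inr h.symm
    · rintro p q r (h | h) (h' | h')
      · exact Or.inl (h.trans h')
      · exact Or.inr (h ▸ h')
      · exact Or.inr (h' ▸ h)
      · exact Or.inr ⟨h.1, h'.2⟩

/-- The quotient space of the subspace `{(a, b, t) | ‖b‖ ≤ t, b ∈ S if t ≠ 0}` of `F × Y × [0, 1]`
by the identifications `(a, b, 1) ∼ (a', b, 1)` and with all points `(c₀, b, t)` collapsed. -/
def JoinQ : Type _ := Quotient (joinSetoid c₀ S)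

instance [TopologicalSpace F] : TopologicalSpace (JoinQ c₀ S) :=
  inferInstanceAs (TopologicalSpace (Quotient _))

/-- The inclusion of the end `F`. -/
def JoinQ.incl (a : F) : JoinQ c₀ S :=
  Quotient.mk (joinSetoid c₀ S) ⟨(a, 0, 0), by simp, fun h => absurd rfl h⟩

variable {c₀ S} [TopologicalSpace F]
variable {F' : Type*} [TopologicalSpace F'] {c₀' : F'} {Y' : Type*} [NormedAddCommGroup Y']
  {S' : Set Y'}

/-- The join `(1 - t) a + t b ↦ (1 - t) f(a) + t s(b)` of two maps. -/
def JoinPre.map (f : C(F, F')) (s : C(Y, Y')) (hs : ∀ b, ‖s b‖ = ‖b‖)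
    (hS : ∀ b ∈ S, s b ∈ S') (p : JoinPre F S) : JoinPre F' S' :=
  ⟨(f p.1.1, s p.1.2.1, p.1.2.2), by
    refine ⟨?_, fun h => hS _ (p.2.2 h)⟩
    change ‖s p.1.2.1‖ ≤ _
    rw [hs]
    exact p.2.1⟩

/-- The map induced on the quotient by the join of two maps. -/
def JoinQ.map (f : C(F, F')) (hf : f c₀ = c₀') (s : C(Y, Y')) (hs : ∀ b, ‖s b‖ = ‖b‖)
    (hS : ∀ b ∈ S, s b ∈ S') : C(JoinQ c₀ S, JoinQ c₀' S') where
  toFun := Quotient.map (JoinPre.map f s hs hS) (by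
    rintro p q (h | ⟨h, h'⟩)
    · exact Or.inl (congrArg _ h)
    · refine Or.inr ⟨?_, ?_⟩
      · exact h.imp (fun h => (congrArg f h).trans hf) id
      · exact h'.imp (fun h => (congrArg f h).trans hf) id)
  continuous_toFun := by
    refine Continuous.quotient_map' ?_ _
    refine Continuous.subtype_mk ?_ _
    have h1 : Continuous (fun p : JoinPre F S => p.1) := continuous_subtype_val
    exact (f.continuous.comp (continuous_fst.comp h1)).prodMk
      ((s.continuous.comp (continuous_fst.comp (continuous_snd.comp h1))).prodMk
        (continuous_snd.comp (continuous_snd.comp h1)))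

end Join

variable (E) in
/-- The based `C_G(g)`-space `QE_g(G, V)`. -/
abbrev QEg (ρ : OrthRep G V) (g : G) : Type _ := JoinQ (Fsp.pt E ρ g) (Ssp ρ g)

/-- The inclusion of the end `F_g(G, V)` in `QE_g(G, V)`. -/
def QEg.incl (ρ : OrthRep G V) (g : G) (a : Fsp E ρ g) : QEg E ρ g := JoinQ.incl _ _ a

/-- For `x g = g' x`, the action of `x` as a map `QE_g(G, V) → QE_{g'}(G, V)`. For `g = g'` this
is the action of `x ∈ C_G(g)` on `QE_g(G, V)`. -/
def QEg.conj (ρ : OrthRep G V) {x g g' : G} (h : x * g = g' * x) : C(QEg E ρ g, QEg E ρ g') :=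
  JoinQ.map (Fsp.conj ρ h) (Fsp.conj_pt ρ h) (symConj ρ x) (SymAlg.norm_map _)
    (fun _ hb => symConj_mem ρ h hb)

/-- The map `r_{φ, τ} : QE_{φ(τ)}(G, V) → QE_τ(H, V)` induced by the join of the restriction map
with the identity. -/
def QEg.res (ρ : OrthRep G V) (φ : H →ₜ* G) (τ : H) :
    C(QEg E ρ (φ τ), QEg E (ρ.res φ) τ) :=
  JoinQ.map (Fsp.res ρ φ τ) (Fsp.res_pt ρ φ τ) (ContinuousMap.id (SymAlg V)) (fun _ => rfl)
    (fun _ hb => hb)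

theorem QEg.conj_mul (ρ : OrthRep G V) {x y g g' g'' : G} (h : y * g = g' * y)
    (h' : x * g' = g'' * x) (h'' : (x * y) * g = g'' * (x * y)) (p : QEg E ρ g) :
    QEg.conj ρ h'' p = QEg.conj ρ h' (QEg.conj ρ h p) := by
  induction p using Quotient.ind with
  | _ p =>
    refine congrArg (Quotient.mk _) (Subtype.ext (Prod.ext ?_ (Prod.ext ?_ rfl)))
    · exact Fsp.conj_mul ρ h h' h'' p.1.1
    · exact symConj_mul ρ x y p.1.2.1

theorem QEg.conj_congr (ρ : OrthRep G V) {x x' g g' : G} (e : x = x') (h : x * g = g' * x)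
    (h' : x' * g = g' * x') : (QEg.conj ρ h : C(QEg E ρ g, QEg E ρ g')) = QEg.conj ρ h' := by
  subst e
  rfl

theorem QEg.res_conj (ρ : OrthRep G V) (φ : H →ₜ* G) {x τ τ' : H} (h : x * τ = τ' * x)
    (h' : φ x * φ τ = φ τ' * φ x) (p : QEg E ρ (φ τ)) :
    QEg.res ρ φ τ' (QEg.conj ρ h' p) = QEg.conj (ρ.res φ) h (QEg.res ρ φ τ p) := by
  induction p using Quotient.ind with
  | _ p =>
    refine congrArg (Quotient.mk _) (Subtype.ext (Prod.ext ?_ rfl))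
    exact Fsp.res_conj ρ φ h h' p.1.1

/-! ### The spaces `Map_{C_G(g)}(G, QE_g(G, V))` and `QE(G, V)` -/

variable (E) in
/-- `Map_{C_G(g)}(G, QE_g(G, V))`: continuous maps `α` with `α(a y) = a · α(y)` for `a ∈ C_G(g)`. -/
def EqMap (ρ : OrthRep G V) (g : G) : Type _ :=
  {α : C(G, QEg E ρ g) // ∀ (a : G) (h : a * g = g * a) (y : G), α (a * y) = QEg.conj ρ h (α y)}

instance (ρ : OrthRep G V) (g : G) : TopologicalSpace (EqMap E ρ g) :=
  inferInstanceAs (TopologicalSpace (Subtype _))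

/-- The action `(x · α)(y) = α(y x)` of `G` on `Map_{C_G(g)}(G, QE_g(G, V))`. -/
instance [ContinuousMul G] (ρ : OrthRep G V) (g : G) : MulAction G (EqMap E ρ g) where
  smul x α := ⟨⟨fun y => α.1 (y * x), α.1.continuous.comp (continuous_mul_const x)⟩, by
    intro a h y
    change α.1 (a * y * x) = _
    rw [mul_assoc]
    exact α.2 a h (y * x)⟩
  one_smul α := Subtype.ext (ContinuousMap.ext fun y => congrArg α.1 (mul_one y))
  mul_smul x y α := Subtype.ext (ContinuousMap.ext fun z => congrArg α.1 (mul_assoc z x y).symm)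

/-- `R_{φ, τ} : Map_{C_G(φ(τ))}(G, QE_{φ(τ)}(G, V)) → Map_{C_H(τ)}(H, QE_τ(H, V))`,
`α ↦ r_{φ, τ} ∘ α ∘ φ`. -/
def EqMap.res (ρ : OrthRep G V) (φ : H →ₜ* G) (τ : H) :
    C(EqMap E ρ (φ τ), EqMap E (ρ.res φ) τ) where
  toFun α := ⟨((QEg.res ρ φ τ).comp α.1).comp (φ : C(H, G)), by
    intro a h y
    have h' : φ a * φ τ = φ τ * φ a := by rw [← map_mul, h, map_mul]
    change QEg.res ρ φ τ (α.1 (φ (a * y))) = QEg.conj (ρ.res φ) h (QEg.res ρ φ τ (α.1 (φ y)))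
    rw [map_mul, α.2 _ h', QEg.res_conj ρ φ h h']⟩
  continuous_toFun := by
    refine Continuous.subtype_mk ?_ _
    exact (ContinuousMap.continuous_precomp _).comp
      ((ContinuousMap.continuous_postcomp _).comp continuous_subtype_val)

/-- The set `G^tors` of torsion elements. -/
abbrev Tors (G : Type*) [Group G] : Type _ := {g : G // IsOfFinOrder g}

/-- The map on torsion elements induced by a homomorphism. -/
def Tors.map (φ : H →ₜ* G) (τ : Tors H) : Tors G :=
  ⟨φ τ.1, φ.toMonoidHom.isOfFinOrder τ.2⟩

variable (E) in
/-- `QE(G, V) = ∏_{g ∈ G^tors} Map_{C_G(g)}(G, QE_g(G, V))`. -/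
abbrev QE (ρ : OrthRep G V) : Type _ := ∀ g : Tors G, EqMap E ρ g.1

variable (E) in
/-- The restriction map `φ^*_V : QE(G, V) → QE(H, V)`. Its component at `τ ∈ H^tors` is
`R_{φ, τ}`, applied to the component at `φ(τ)`. -/
def QE.res (ρ : OrthRep G V) (φ : H →ₜ* G) : C(QE E ρ, QE E (ρ.res φ)) where
  toFun α τ := EqMap.res ρ φ τ.1 (α (Tors.map φ τ))
  continuous_toFun := continuous_pi fun τ =>
    (EqMap.res ρ φ τ.1).continuous.comp (continuous_apply (Tors.map φ τ))

/-! ### The product over conjugacy classes of torsion elements -/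

/-- A set `G^tors_conj` of representatives of the conjugacy classes of torsion elements. -/
structure TorsReps (G : Type*) [Group G] where
  /-- The set of representatives. -/
  carrier : Set G
  isOfFinOrder : ∀ g ∈ carrier, IsOfFinOrder g
  existsUnique : ∀ g : G, IsOfFinOrder g → ∃! r, r ∈ carrier ∧ IsConj r g

/-- The representative of the conjugacy class of `g`. -/
def TorsReps.rep (T : TorsReps G) (g : Tors G) : T.carrier :=
  ⟨(T.existsUnique g.1 g.2).choose, (T.existsUnique g.1 g.2).choose_spec.1.1⟩

/-- An element `x` with `x r x⁻¹ = g`, where `r` is the representative of the class of `g`. -/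
def TorsReps.conjugator (T : TorsReps G) (g : Tors G) : G :=
  (isConj_iff.mp (T.existsUnique g.1 g.2).choose_spec.1.2).choose

theorem TorsReps.conjugator_spec (T : TorsReps G) (g : Tors G) :
    T.conjugator g * (T.rep g).1 = g.1 * T.conjugator g :=
  mul_inv_eq_iff_eq_mul.mp (isConj_iff.mp (T.existsUnique g.1 g.2).choose_spec.1.2).choose_spec

/-- For `x g = g' x`, the isomorphism
`Map_{C_G(g)}(G, QE_g(G, V)) → Map_{C_G(g')}(G, QE_{g'}(G, V))`, `α ↦ (y ↦ x · α(x⁻¹ y))`. -/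
def EqMap.conj [ContinuousMul G] (ρ : OrthRep G V) {x g g' : G} (h : x * g = g' * x) :
    C(EqMap E ρ g, EqMap E ρ g') where
  toFun α := ⟨((QEg.conj ρ h).comp α.1).comp ⟨fun y => x⁻¹ * y, continuous_const_mul x⁻¹⟩, by
    intro a ha y
    have h1 : (x⁻¹ * a * x) * g = g * (x⁻¹ * a * x) := by
      have e : g = x⁻¹ * g' * x := by rw [mul_assoc, ← h, inv_mul_cancel_left]
      rw [e]
      simp only [mul_assoc, mul_inv_cancel_left]
      rw [← mul_assoc a g', ha, mul_assoc]
    have h2 : (x * (x⁻¹ * a * x)) * g = g' * (x * (x⁻¹ * a * x)) := by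
      rw [mul_assoc, h1, ← mul_assoc, h, mul_assoc]
    have h3 : (a * x) * g = g' * (a * x) := by
      rw [mul_assoc, h, ← mul_assoc, ha, mul_assoc]
    change QEg.conj ρ h (α.1 (x⁻¹ * (a * y))) = QEg.conj ρ ha (QEg.conj ρ h (α.1 (x⁻¹ * y)))
    have e1 : x⁻¹ * (a * y) = (x⁻¹ * a * x) * (x⁻¹ * y) := by
      simp only [mul_assoc, mul_inv_cancel_left]
    rw [e1, α.2 _ h1, ← QEg.conj_mul ρ h1 h h2, ← QEg.conj_mul ρ h ha h3]
    have e2 : x * (x⁻¹ * a * x) = a * x := by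
      simp only [mul_assoc, mul_inv_cancel_left]
    exact DFunLike.congr_fun (QEg.conj_congr ρ e2 h2 h3) _⟩
  continuous_toFun := by
    refine Continuous.subtype_mk ?_ _
    exact (ContinuousMap.continuous_precomp _).comp
      ((ContinuousMap.continuous_postcomp _).comp continuous_subtype_val)

variable (E) in
/-- `∏_{g ∈ G^tors_conj} Map_{C_G(g)}(G, QE_g(G, V))`. -/
abbrev QEconj (T : TorsReps G) (ρ : OrthRep G V) : Type _ := ∀ g : T.carrier, EqMap E ρ g.1

variable (E) in
/-- The extension of a family indexed by `G^tors_conj` to a conjugation-invariant family indexed by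
`G^tors`. -/
def QEconj.extend [ContinuousMul G] (T : TorsReps G) (ρ : OrthRep G V) :
    C(QEconj E T ρ, QE E ρ) where
  toFun α g := EqMap.conj ρ (T.conjugator_spec g) (α (T.rep g))
  continuous_toFun := continuous_pi fun g =>
    (EqMap.conj ρ (T.conjugator_spec g)).continuous.comp (continuous_apply (T.rep g))

variable (E) in
/-- The projection from the product over `G^tors` to the product over `G^tors_conj`. -/
def QEconj.proj (T : TorsReps G) (ρ : OrthRep G V) : C(QE E ρ, QEconj E T ρ) where
  toFun α g := α ⟨g.1, T.isOfFinOrder g.1 g.2⟩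
  continuous_toFun := continuous_pi fun g =>
    continuous_apply (⟨g.1, T.isOfFinOrder g.1 g.2⟩ : Tors G)

variable (E) in
/-- The restriction map between the products over conjugacy classes. -/
def QEconj.res [ContinuousMul G] (T : TorsReps G) (T' : TorsReps H) (ρ : OrthRep G V)
    (φ : H →ₜ* G) : C(QEconj E T ρ, QEconj E T' (ρ.res φ)) :=
  ((QEconj.proj E T' (ρ.res φ)).comp (QE.res E ρ φ)).comp (QEconj.extend E T ρ)

end QERes
end

open QERes

/-!
A continuous `G`-map `f` into `Map_{C_G(g)}(G, QE_g(G, V))` sends a `g`-fixed point `p` to a map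
`α` with `α = g • α`. Equivariance of `α` under `g ∈ C_G(g)` then gives
`α(1) = α(1 · g) = α(g · 1) = g · α(1)`, so `α(1)` is a `g`-fixed point of `QE_g(G, V)`. A
point `(1 - t) a + t b` with `t ≠ 0` outside the collapsed class is moved by `g`, since
`b ∈ Sym(V) ∖ Sym(V)^g`; the fixed points therefore lie in the end `F_g(G, V)`, which contains the
collapsed point as its base point (`QEg.exists_incl_of_conj_eq`). On the end, `r_{φ, τ}` is the
restriction map `β ↦ E(a_τ) ∘ β` by definition.

Functoriality is inherited from that of `E`, because the isometries `a_τ` compose and `a_τ` is the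
identity for `φ = id`.

For the products over conjugacy classes, call a family indexed by `G^tors` conjugation-invariant if
its component at `g' = x g x⁻¹` is the `x`-conjugate of its component at `g`. Conjugating an
element of `Map_{C_G(g)}(G, QE_g(G, V))` by `x` depends only on `x g x⁻¹` (`EqMap.conj_eq_conj`), so
extensions from representatives do not depend on the chosen conjugators. Extension and projection
are therefore mutually inverse between the product over representatives and the invariant families
(`QEconj.extend_proj`, `QEconj.proj_extend`), and the restriction maps preserve invariance
(`QE.IsConjInvariant.res`). The statements about conjugacy classes follow formally.
-/

namespace QERes

/-! ### The end of the join -/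

section Join

variable {F : Type*} {c₀ : F} {Y : Type*} [NormedAddCommGroup Y] {S : Set Y}

theorem JoinQ.incl_injective : Function.Injective (JoinQ.incl c₀ S) := by
  intro a a' h
  rcases Quotient.exact h with h | ⟨h, h'⟩
  · exact congrArg (fun p : JoinPre F S => p.1.1) h
  · have h1 : a = c₀ := h.resolve_right (zero_ne_one (α := unitInterval))
    have h2 : a' = c₀ := h'.resolve_right (zero_ne_one (α := unitInterval))
    exact h1.trans h2.symm

/-- If `s` moves every point of `S`, the points of the quotient fixed by the join of `f` and `s`
lie in the end `F`. -/
theorem JoinQ.exists_incl_of_map_eq [TopologicalSpace F] (f : C(F, F)) (hf : f c₀ = c₀)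
    (s : C(Y, Y)) (hs : ∀ b, ‖s b‖ = ‖b‖) (hS : ∀ b ∈ S, s b ∈ S) (hmove : ∀ b ∈ S, s b ≠ b)
    (q : JoinQ c₀ S) (hq : JoinQ.map f hf s hs hS q = q) : ∃ a, q = JoinQ.incl c₀ S a := by
  induction q using Quotient.ind with
  | _ p =>
    obtain ⟨⟨a, b, t⟩, hb, hbS⟩ := p
    by_cases ht : t = 0
    · subst ht
      have hb0 : b = 0 := norm_le_zero_iff.mp hb
      subst hb0
      exact ⟨a, rfl⟩
    · rcases Quotient.exact hq with h | ⟨-, h⟩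
      · exact absurd (congrArg (fun p : JoinPre F S => p.1.2.1) h) (hmove b (hbS ht))
      · exact ⟨c₀, Quotient.sound (Or.inr ⟨h, Or.inl rfl⟩)⟩

end Join

/-! ### Representatives of conjugacy classes -/

section Representatives

variable {G : Type*} [Group G]

theorem TorsReps.rep_eq (T : TorsReps G) (g : Tors G) (r : T.carrier) (h : IsConj r.1 g.1) :
    T.rep g = r :=
  Subtype.ext ((T.existsUnique g.1 g.2).unique (T.existsUnique g.1 g.2).choose_spec.1 ⟨r.2, h⟩)

theorem isConj_of_mul_eq {x g g' : G} (h : x * g = g' * x) : IsConj g g' :=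
  isConj_iff.mpr ⟨x, mul_inv_eq_iff_eq_mul.mpr h⟩

end Representatives

/-! ### Fixed points in `QE_g(G, V)` -/

variable {G : Type*} [Group G] [TopologicalSpace G] {H : Type*} [Group H] [TopologicalSpace H]
  {K : Type*} [Group K] [TopologicalSpace K]
  {V : Type u} [NormedAddCommGroup V] [InnerProductSpace ℝ V] [FiniteDimensional ℝ V]
  {E : IsoFunctor.{u, w}}

theorem QEg.incl_injective (ρ : OrthRep G V) (g : G) :
    Function.Injective (QEg.incl (E := E) ρ g) :=
  JoinQ.incl_injective

theorem QEg.res_incl (ρ : OrthRep G V) (φ : H →ₜ* G) (τ : H) (a : Fsp E ρ (φ τ)) :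
    QEg.res ρ φ τ (QEg.incl ρ (φ τ) a) = QEg.incl (ρ.res φ) τ (Fsp.res ρ φ τ a) :=
  rfl

/-- The `g`-fixed points of `QE_g(G, V)` lie in the end `F_g(G, V)`. -/
theorem QEg.exists_incl_of_conj_eq (ρ : OrthRep G V) {g : G} (h : g * g = g * g)
    (q : QEg E ρ g) (hq : QEg.conj ρ h q = q) : ∃ a, q = QEg.incl ρ g a :=
  JoinQ.exists_incl_of_map_eq (S := Ssp ρ g) (Fsp.conj ρ h) (Fsp.conj_pt ρ h) (symConj ρ g)
    (SymAlg.norm_map _) (fun _ hb => symConj_mem ρ h hb) (fun _ hb => hb) q hq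

/-- If `α` is fixed by `g`, then `α(1)` lies in the end `F_g(G, V)`. -/
theorem EqMap.exists_incl_of_smul_eq [ContinuousMul G] (ρ : OrthRep G V) {g : G}
    (α : EqMap E ρ g) (hα : g • α = α) : ∃ a, α.1 1 = QEg.incl ρ g a := by
  refine QEg.exists_incl_of_conj_eq ρ rfl _ ?_
  have h1 : α.1 (1 * g) = α.1 1 := DFunLike.congr_fun (congrArg Subtype.val hα) 1
  rw [← α.2 g rfl 1, mul_one, ← h1, one_mul]

theorem EqMap.res_smul [ContinuousMul G] [ContinuousMul H] (ρ : OrthRep G V) (φ : H →ₜ* G)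
    (τ h : H) (α : EqMap E ρ (φ τ)) : EqMap.res ρ φ τ (φ h • α) = h • EqMap.res ρ φ τ α := by
  refine Subtype.ext (ContinuousMap.ext fun y => ?_)
  change QEg.res ρ φ τ (α.1 (φ y * φ h)) = QEg.res ρ φ τ (α.1 (φ (y * h)))
  rw [map_mul φ]

/-! ### Functoriality of the restriction maps -/

theorem Fsp.res_res (ρ : OrthRep G V) (φ : H →ₜ* G) (ψ : K →ₜ* H) (τ : K)
    (β : Fsp E ρ (φ (ψ τ))) :
    Fsp.res (ρ.res φ) ψ τ (Fsp.res ρ φ (ψ τ) β) = Fsp.res ρ (φ.comp ψ) τ β :=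
  Subtype.ext (ContinuousMap.ext fun z =>
    (E.map_trans (aIso ρ φ (ψ τ)) (aIso (ρ.res φ) ψ τ) (β.1 z)).symm)

theorem Fsp.res_id (ρ : OrthRep G V) (τ : G) (β : Fsp E ρ τ) :
    Fsp.res ρ (ContinuousMonoidHom.id G) τ β = β :=
  Subtype.ext (ContinuousMap.ext fun z => E.map_refl (β.1 z))

theorem QEg.res_res (ρ : OrthRep G V) (φ : H →ₜ* G) (ψ : K →ₜ* H) (τ : K)
    (q : QEg E ρ (φ (ψ τ))) :
    QEg.res (ρ.res φ) ψ τ (QEg.res ρ φ (ψ τ) q) = QEg.res ρ (φ.comp ψ) τ q := by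
  induction q using Quotient.ind with
  | _ p =>
    exact congrArg (Quotient.mk _) (Subtype.ext (Prod.ext (Fsp.res_res ρ φ ψ τ p.1.1) rfl))

theorem QEg.res_id (ρ : OrthRep G V) (τ : G) (q : QEg E ρ τ) :
    QEg.res ρ (ContinuousMonoidHom.id G) τ q = q := by
  induction q using Quotient.ind with
  | _ p => exact congrArg (Quotient.mk _) (Subtype.ext (Prod.ext (Fsp.res_id ρ τ p.1.1) rfl))

theorem QE.res_comp_res (ρ : OrthRep G V) (φ : H →ₜ* G) (ψ : K →ₜ* H) :
    (QE.res E (ρ.res φ) ψ).comp (QE.res E ρ φ) = QE.res E ρ (φ.comp ψ) :=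
  ContinuousMap.ext fun _ => funext fun τ => Subtype.ext (ContinuousMap.ext fun _ =>
    QEg.res_res ρ φ ψ τ.1 _)

theorem QE.res_id (ρ : OrthRep G V) :
    QE.res E ρ (ContinuousMonoidHom.id G) = ContinuousMap.id (QE E ρ) :=
  ContinuousMap.ext fun _ => funext fun τ => Subtype.ext (ContinuousMap.ext fun _ =>
    QEg.res_id ρ τ.1 _)

/-! ### Conjugation-invariant families -/

section Conj

variable [ContinuousMul G] [ContinuousMul H]

/-- Conjugation by an element of the centralizer is the identity. -/
theorem EqMap.conj_self (ρ : OrthRep G V) {x g : G} (h : x * g = g * x) (α : EqMap E ρ g) :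
    EqMap.conj ρ h α = α := by
  refine Subtype.ext (ContinuousMap.ext fun y => ?_)
  change QEg.conj ρ h (α.1 (x⁻¹ * y)) = α.1 y
  rw [← α.2 x h, mul_inv_cancel_left]

theorem EqMap.conj_conj (ρ : OrthRep G V) {x y g g' g'' : G} (h : y * g = g' * y)
    (h' : x * g' = g'' * x) (h'' : (x * y) * g = g'' * (x * y)) (α : EqMap E ρ g) :
    EqMap.conj ρ h' (EqMap.conj ρ h α) = EqMap.conj ρ h'' α := by
  refine Subtype.ext (ContinuousMap.ext fun z => ?_)
  change QEg.conj ρ h' (QEg.conj ρ h (α.1 (y⁻¹ * (x⁻¹ * z)))) =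
    QEg.conj ρ h'' (α.1 ((x * y)⁻¹ * z))
  rw [← QEg.conj_mul ρ h h' h'', mul_inv_rev, mul_assoc]

/-- The conjugation isomorphism from the factor at `g` to the factor at `g'` does not depend on the
conjugating element. -/
theorem EqMap.conj_eq_conj (ρ : OrthRep G V) {x x' g g' : G} (h : x * g = g' * x)
    (h' : x' * g = g' * x') (α : EqMap E ρ g) : EqMap.conj ρ h α = EqMap.conj ρ h' α := by
  have hx : x⁻¹ * g' = g * x⁻¹ := by
    rw [inv_mul_eq_iff_eq_mul, ← mul_assoc, h, mul_inv_cancel_right]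
  -- `x' = (x' * x⁻¹) * x`, where `x' * x⁻¹` centralizes `g'`.
  have hc : (x' * x⁻¹) * g' = g' * (x' * x⁻¹) := by
    rw [mul_assoc, hx, ← mul_assoc, h', mul_assoc]
  rw [← EqMap.conj_self ρ hc (EqMap.conj ρ h α),
    EqMap.conj_conj ρ h hc (by rw [inv_mul_cancel_right, h'])]
  congr 1
  simp only [inv_mul_cancel_right]

theorem EqMap.res_conj (ρ : OrthRep G V) (φ : H →ₜ* G) {x τ τ' : H} (h : x * τ = τ' * x)
    (h' : φ x * φ τ = φ τ' * φ x) (α : EqMap E ρ (φ τ)) :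
    EqMap.res ρ φ τ' (EqMap.conj ρ h' α) = EqMap.conj (ρ.res φ) h (EqMap.res ρ φ τ α) := by
  refine Subtype.ext (ContinuousMap.ext fun z => ?_)
  change QEg.res ρ φ τ' (QEg.conj ρ h' (α.1 ((φ x)⁻¹ * φ z))) =
    QEg.conj (ρ.res φ) h (QEg.res ρ φ τ (α.1 (φ (x⁻¹ * z))))
  rw [QEg.res_conj ρ φ h h', map_mul φ, map_inv φ]

/-- A family indexed by `G^tors` is conjugation-invariant if, whenever `g' = x g x⁻¹`, its
component at `g'` is the `x`-conjugate of its component at `g`. -/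
def QE.IsConjInvariant (ρ : OrthRep G V) (α : QE E ρ) : Prop :=
  ∀ (g g' : Tors G) (x : G) (h : x * g.1 = g'.1 * x), α g' = EqMap.conj ρ h (α g)

theorem QE.IsConjInvariant.res {ρ : OrthRep G V} {α : QE E ρ} (hα : QE.IsConjInvariant ρ α)
    (φ : H →ₜ* G) : QE.IsConjInvariant (ρ.res φ) (QE.res E ρ φ α) := by
  intro τ τ' x h
  have h' : φ x * φ τ.1 = φ τ'.1 * φ x := by rw [← map_mul, h, map_mul]
  refine Eq.trans ?_ (EqMap.res_conj ρ φ h h' (α (Tors.map φ τ)))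
  exact congrArg (EqMap.res ρ φ τ'.1) (hα (Tors.map φ τ) (Tors.map φ τ') (φ x) h')

/-- The extension of a family may be computed with any element conjugating a representative to
`g`. -/
theorem QEconj.extend_apply_eq (T : TorsReps G) (ρ : OrthRep G V) (α : QEconj E T ρ) (g : Tors G)
    (r : T.carrier) {x : G} (h : x * r.1 = g.1 * x) :
    QEconj.extend E T ρ α g = EqMap.conj ρ h (α r) := by
  obtain rfl := T.rep_eq g r (isConj_of_mul_eq h)
  exact EqMap.conj_eq_conj ρ _ h _

theorem QEconj.isConjInvariant_extend (T : TorsReps G) (ρ : OrthRep G V) (α : QEconj E T ρ) :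
    QE.IsConjInvariant ρ (QEconj.extend E T ρ α) := by
  intro g g' x h
  have h1 := T.conjugator_spec g
  have h2 : (x * T.conjugator g) * (T.rep g).1 = g'.1 * (x * T.conjugator g) := by
    rw [mul_assoc, h1, ← mul_assoc, h, mul_assoc]
  rw [QEconj.extend_apply_eq T ρ α g' _ h2, QEconj.extend_apply_eq T ρ α g _ h1,
    EqMap.conj_conj ρ h1 h h2]

theorem QEconj.extend_proj (T : TorsReps G) {ρ : OrthRep G V} {α : QE E ρ}
    (hα : QE.IsConjInvariant ρ α) : QEconj.extend E T ρ (QEconj.proj E T ρ α) = α :=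
  funext fun g =>
    (hα ⟨(T.rep g).1, T.isOfFinOrder _ (T.rep g).2⟩ g (T.conjugator g) (T.conjugator_spec g)).symm

theorem QEconj.proj_extend (T : TorsReps G) (ρ : OrthRep G V) (α : QEconj E T ρ) :
    QEconj.proj E T ρ (QEconj.extend E T ρ α) = α :=
  funext fun g =>
    (QEconj.extend_apply_eq T ρ α ⟨g.1, T.isOfFinOrder g.1 g.2⟩ g
      (x := 1) ((one_mul _).trans (mul_one _).symm)).trans (EqMap.conj_self ρ _ _)

theorem QEconj.res_comp_extend (T : TorsReps G) (T' : TorsReps H) (ρ : OrthRep G V)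
    (φ : H →ₜ* G) :
    (QE.res E ρ φ).comp (QEconj.extend E T ρ) =
      (QEconj.extend E T' (ρ.res φ)).comp (QEconj.res E T T' ρ φ) :=
  ContinuousMap.ext fun α =>
    (QEconj.extend_proj T' ((QEconj.isConjInvariant_extend T ρ α).res φ)).symm

theorem QEconj.res_comp_res [ContinuousMul K] (T : TorsReps G) (T' : TorsReps H)
    (T'' : TorsReps K) (ρ : OrthRep G V) (φ : H →ₜ* G) (ψ : K →ₜ* H) :
    (QEconj.res E T' T'' (ρ.res φ) ψ).comp (QEconj.res E T T' ρ φ) =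
      QEconj.res E T T'' ρ (φ.comp ψ) := by
  refine ContinuousMap.ext fun α => ?_
  have h := DFunLike.congr_fun (QEconj.res_comp_extend (E := E) T T' ρ φ) α
  have h' := DFunLike.congr_fun (QE.res_comp_res (E := E) ρ φ ψ) (QEconj.extend E T ρ α)
  exact congrArg (QEconj.proj E T'' ((ρ.res φ).res ψ))
    ((congrArg (QE.res E (ρ.res φ) ψ) h.symm).trans h')

theorem QEconj.res_id (T : TorsReps G) (ρ : OrthRep G V) :
    QEconj.res E T T ρ (ContinuousMonoidHom.id G) = ContinuousMap.id (QEconj E T ρ) := by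
  refine ContinuousMap.ext fun α => ?_
  have h := DFunLike.congr_fun (QE.res_id (E := E) ρ) (QEconj.extend E T ρ α)
  exact (congrArg (QEconj.proj E T ρ) h).trans (QEconj.proj_extend T ρ α)

end Conj

end QERes

/-! ### The restriction maps -/

theorem mainTheorem10
    {G : Type*} [Group G] [TopologicalSpace G] [IsTopologicalGroup G]
    {H : Type*} [Group H] [TopologicalSpace H] [IsTopologicalGroup H]
    {K : Type*} [Group K] [TopologicalSpace K] [IsTopologicalGroup K]
    {L : Type*} [Group L] [TopologicalSpace L] [IsTopologicalGroup L]
    {V : Type u} [NormedAddCommGroup V] [InnerProductSpace ℝ V] [FiniteDimensional ℝ V]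
    (E : IsoFunctor.{u, w}) (ρ : OrthRep G V)
    (φ : H →ₜ* G) (ψ : K →ₜ* H) (χ : L →ₜ* K) :
    -- (i) the square of evaluations at the neutral element
    (∀ τ : H, IsOfFinOrder τ →
      Function.Injective (QEg.incl (E := E) ρ (φ τ)) ∧
      Function.Injective (QEg.incl (E := E) (ρ.res φ) τ) ∧
      (∀ a : Fsp E ρ (φ τ),
        QEg.res ρ φ τ (QEg.incl ρ (φ τ) a) = QEg.incl (ρ.res φ) τ (Fsp.res ρ φ τ a)) ∧
      (∀ α : EqMap E ρ (φ τ), (EqMap.res ρ φ τ α).1 1 = QEg.res ρ φ τ (α.1 1)) ∧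
      (∀ (h : H) (α : EqMap E ρ (φ τ)), EqMap.res ρ φ τ (φ h • α) = h • EqMap.res ρ φ τ α) ∧
      (∀ (X : Type v) [TopologicalSpace X] [MulAction G X] [ContinuousSMul G X]
        (f : C(X, EqMap E ρ (φ τ))), (∀ (x : G) (p : X), f (x • p) = x • f p) →
        ∀ p : X, φ τ • p = p → ∃ a : Fsp E ρ (φ τ),
          (f p).1 1 = QEg.incl ρ (φ τ) a ∧
          (EqMap.res ρ φ τ (f p)).1 1 = QEg.incl (ρ.res φ) τ (Fsp.res ρ φ τ a))) ∧
    (∀ (X : Type v) [TopologicalSpace X] [MulAction G X] [ContinuousSMul G X]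
      (f : C(X, QE E ρ)), (∀ (x : G) (p : X), f (x • p) = x • f p) →
      ∀ (τ : Tors H) (p : X), φ τ.1 • p = p → ∃ a : Fsp E ρ (φ τ.1),
        (f p (Tors.map φ τ)).1 1 = QEg.incl ρ (φ τ.1) a ∧
        (QE.res E ρ φ (f p) τ).1 1 = QEg.incl (ρ.res φ) τ.1 (Fsp.res ρ φ τ.1 a)) ∧
    -- (ii) functoriality and associativity of the composition
    (QE.res E (ρ.res φ) ψ).comp (QE.res E ρ φ) = QE.res E ρ (φ.comp ψ) ∧
    (QE.res E ((ρ.res φ).res ψ) χ).comp ((QE.res E (ρ.res φ) ψ).comp (QE.res E ρ φ)) =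
      ((QE.res E ((ρ.res φ).res ψ) χ).comp (QE.res E (ρ.res φ) ψ)).comp (QE.res E ρ φ) ∧
    -- (iii) the identity
    QE.res E ρ (ContinuousMonoidHom.id G) = ContinuousMap.id (QE E ρ) ∧
    -- the same for the products over conjugacy classes of torsion elements
    (∀ (T : TorsReps G) (T' : TorsReps H) (T'' : TorsReps K),
      (QE.res E ρ φ).comp (QEconj.extend E T ρ) =
        (QEconj.extend E T' (ρ.res φ)).comp (QEconj.res E T T' ρ φ) ∧
      (QEconj.res E T' T'' (ρ.res φ) ψ).comp (QEconj.res E T T' ρ φ) =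
        QEconj.res E T T'' ρ (φ.comp ψ) ∧
      QEconj.res E T T ρ (ContinuousMonoidHom.id G) = ContinuousMap.id (QEconj E T ρ)) := by
  refine ⟨fun τ _ => ⟨QEg.incl_injective ρ _, QEg.incl_injective _ τ, QEg.res_incl ρ φ τ, ?_,
    fun h α => EqMap.res_smul ρ φ τ h α, ?_⟩, ?_, QE.res_comp_res ρ φ ψ, rfl, QE.res_id ρ,
    fun T T' T'' => ⟨QEconj.res_comp_extend T T' ρ φ, QEconj.res_comp_res T T' T'' ρ φ ψ,
      QEconj.res_id T ρ⟩⟩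
  · intro α
    exact congrArg (fun y => QEg.res ρ φ τ (α.1 y)) (map_one φ)
  · intro X _ _ _ f hf p hp
    obtain ⟨a, ha⟩ := EqMap.exists_incl_of_smul_eq ρ (f p) (by rw [← hf, hp])
    refine ⟨a, ha, ?_⟩
    change QEg.res ρ φ τ ((f p).1 (φ 1)) = _
    rw [map_one, ha, QEg.res_incl]
  · intro X _ _ _ f hf τ p hp
    obtain ⟨a, ha⟩ := EqMap.exists_incl_of_smul_eq ρ (f p (Tors.map φ τ)) (by
      have h := congrFun (hf (φ τ.1) p) (Tors.map φ τ)
      rw [hp] at h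
      exact h.symm)
    refine ⟨a, ha, ?_⟩
    change QEg.res ρ φ τ.1 ((f p (Tors.map φ τ)).1 (φ 1)) = _
    rw [map_one]
    exact congrArg (QEg.res ρ φ τ.1) ha
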